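/- Let $L$ be a finite set of outcomes, $B$ a fixed number of transformations, and consider a sequence of experiments, each with $N$ independent clusters of sizes $n_1,\dots,n_N$ and $n=\sum_{j}n_j\to\infty$ observations per outcome. For $l\in L$ and cluster $j$ there are a response $y_{jl}\in\mathbb R^{n_j}$, a covariate of interest $x_{jl}\in\mathbb R^{n_j}$, nuisance covariates $Z_{jl}\in\mathbb R^{n_j\times q_l}$ (covariates random or nonrandom) and a symmetric positive definite weight matrix $W_{jl}$, which is constant or a function of the covariates. Let $\mathcal D$ be the $\sigma$-algebra generated by all the covariates. The clusters $(x_{jl},Z_{jl},y_{jl})_{l\in L}$, $j=1,\dots,N$, are independent. Let $y_l,x_l,Z_l$ be the stacked data, $W_l=\operatorname{diag}(W_{1l},\dots,W_{Nl})$, assume $Z_l^\top W_lZ_l$ is almost surely nonsingular, and set $H_l=W_l^{1/2}Z_l(Z_l^\top W_lZ_l)^{-1}Z_l^\top W_l^{1/2}$. For hypothesised values $\beta_l^0$ let $\hat\gamma_l=(Z_l^\top W_lZ_l)^{-1}Z_l^\top W_l(y_l-x_l\beta_l^0)$ and, for $\gamma\in\mathbb R^{q_l}$, $$\zeta_{jl}^{\gamma}=\bigl[(I-H_l)W_l^{1/2}x_l\bigr]_j^\top\bigl[W_l^{1/2}(y_l-x_l\beta_l^0-Z_l\gamma)\bigr]_j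 ,$$ where $[\cdot]_j$ is the subvector of cluster $j$. Fix the true parameters $\beta_l\in\mathbb R$ and $\gamma_l^\star\in\mathbb R^{q_l}$, and write $\zeta_j^{\gamma^\star}=(\zeta_{jl}^{\gamma_l^\star})_{l\in L}$ and $\zeta_j^{\hat\gamma}=(\zeta_{jl}^{\hat\gamma_l})_{l\in L}$. Assume the null hypothesis $\beta_l=\beta_l^0$ for all $l\in L$, and: 1. the responses are integrable and $\mathbb E\bigl(y_{jl}\mid (x_{jk},Z_{jk})_{k\in L}\bigr)=x_{jl}\beta_l+Z_{jl}\gamma_l^\star$ for all $l\in L$ and all $j$; 2. $\max_j n_j/n\to0$; 3. there is $d>2$ with $n^{-d/2}\sum_j\mathbb E\|\zeta_j^{\gamma^\star}\|^d\to0$; 4. there is a matrix $\Sigma_L\in\mathbb R^{L\times L}$ with strictly positive diagonal entries such that $n^{-1}\sum_j\operatorname{Var}(\zeta_j^{\gamma^\star}\mid\mathcal D)\to\Sigma_L$ in probability (for nonrandom covariates this is $n^{-1}\sum_j\operatorname{Var}(\zeta_j^{\gamma^\star})\to\Sigma_L$), and, for every $\epsilon>0$, $n^{-1}\sum_j\mathbb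 E\bigl[\|\zeta_j^{\gamma^\star}\|^2\mathbf 1\{\|\zeta_j^{\gamma^\star}\|>\epsilon\sqrt n\}\bigr]\to0$; 5. there are deterministic $r_n\to\infty$ with $r_n\le\sqrt n$, the same for all $l\in L$, such that $r_n\|\hat\gamma_l-\gamma_l^\star\|=O_p(1)$ for every $l\in L$; 6. $n^{-1/2}\sum_j\|\zeta_j^{\hat\gamma}-\zeta_j^{\gamma^\star}\|=o_p(1)$. Let $s_j^1=1$ for all $j$, let $s_j^b$ ($2\le b\le B$, $1\le j\le N$) be independent signs, uniform on $\{-1,1\}$ and independent of the data, and let $M_n$ be the random $B\times|L|$ matrix with entries $$[M_n]_{bl}=S_l(F_b)=n^{-1/2}\sum_{j=1}^N s_j^b\,\zeta_{jl}^{\hat\gamma_l}.$$ Then $\Sigma_L$ is positive semidefinite and $M_n$ converges in distribution, as $n\to\infty$, to a random matrix whose rows are i.i.d. $N(0,\Sigma_L)$; equivalently, stacking the rows of $M_n$ into one vector, $\operatorname{vec}(M_n)\Rightarrow N(0,I_B\otimes\Sigma_L)$. -/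

import Mathlib

open MeasureTheory ProbabilityTheory Filter Topology
open scoped Matrix MatrixOrder Kronecker ENNReal

universe u v

noncomputable section

/-! ### Score algebra for one outcome and one realised data set

Observations are indexed by pairs `⟨j, i⟩`: occasion `i` in cluster `j`, which has `m j` occasions.
-/

section Score

variable {N : ℕ} {m : Fin N → ℕ} {q : ℕ}

/-- The block diagonal weight matrix with diagonal blocks `W j`. -/
def blockWeight (W : ∀ j, Matrix (Fin (m j)) (Fin (m j)) ℝ) :
    Matrix (Σ j, Fin (m j)) (Σ j, Fin (m j)) ℝ :=
  Matrix.blockDiagonal' W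

/-- The positive semidefinite square root of the block diagonal weight matrix. -/
def sqrtWeight (W : ∀ j, Matrix (Fin (m j)) (Fin (m j)) ℝ) :
    Matrix (Σ j, Fin (m j)) (Σ j, Fin (m j)) ℝ :=
  CFC.sqrt (blockWeight W)

/-- `Zᵀ W Z`. -/
def nuisanceGram (Z : Matrix (Σ j, Fin (m j)) (Fin q) ℝ)
    (W : ∀ j, Matrix (Fin (m j)) (Fin (m j)) ℝ) : Matrix (Fin q) (Fin q) ℝ :=
  Zᵀ * blockWeight W * Z

/-- The projection `H = W^{1/2} Z (Zᵀ W Z)⁻¹ Zᵀ W^{1/2}`. -/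
def hatMatrix (Z : Matrix (Σ j, Fin (m j)) (Fin q) ℝ)
    (W : ∀ j, Matrix (Fin (m j)) (Fin (m j)) ℝ) :
    Matrix (Σ j, Fin (m j)) (Σ j, Fin (m j)) ℝ :=
  sqrtWeight W * Z * (nuisanceGram Z W)⁻¹ * Zᵀ * sqrtWeight W

/-- The generalized least-squares estimator of the nuisance parameter with the coefficient of
interest held at `β₀`: `(Zᵀ W Z)⁻¹ Zᵀ W (y - x β₀)`. -/
def profiledNuisance (x : (Σ j, Fin (m j)) → ℝ) (Z : Matrix (Σ j, Fin (m j)) (Fin q) ℝ)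
    (W : ∀ j, Matrix (Fin (m j)) (Fin (m j)) ℝ) (y : (Σ j, Fin (m j)) → ℝ) (β₀ : ℝ) :
    Fin q → ℝ :=
  (nuisanceGram Z W)⁻¹ *ᵥ (Zᵀ *ᵥ (blockWeight W *ᵥ (y - β₀ • x)))

/-- The contribution of cluster `j` to the effective score, at nuisance value `γ`:
`[(I - H) W^{1/2} x]_jᵀ [W^{1/2} (y - x β₀ - Z γ)]_j`. -/
def clusterScore (x : (Σ j, Fin (m j)) → ℝ) (Z : Matrix (Σ j, Fin (m j)) (Fin q) ℝ)
    (W : ∀ j, Matrix (Fin (m j)) (Fin (m j)) ℝ) (y : (Σ j, Fin (m j)) → ℝ) (β₀ : ℝ)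
    (γ : Fin q → ℝ) (j : Fin N) : ℝ :=
  ∑ i : Fin (m j),
    ((1 - hatMatrix Z W) *ᵥ (sqrtWeight W *ᵥ x)) ⟨j, i⟩ *
      (sqrtWeight W *ᵥ (y - (β₀ • x + Z *ᵥ γ))) ⟨j, i⟩

end Score

/-! ### The random experiment at one stage of the asymptotics -/

/-- One stage of the asymptotic framework: a probability space carrying, for every outcome `l : L`,
the covariate of interest `x`, the nuisance covariates `Z`, the weights `W` and the response `y` of
each of `N` clusters of sizes `size j`, together with `B` vectors of clusterwise signs.
The covariates and weights may be random; constants give a nonrandom design. -/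
structure ClusterExperiment (L : Type v) (q : L → ℕ) (B : ℕ) where
  Ω : Type u
  [mΩ : MeasurableSpace Ω]
  P : Measure Ω
  [isProb : IsProbabilityMeasure P]
  N : ℕ
  size : Fin N → ℕ
  x : Ω → ∀ (_ : L) (j : Fin N), Fin (size j) → ℝ
  Z : Ω → ∀ (l : L) (j : Fin N), Fin (size j) → Fin (q l) → ℝ
  W : Ω → ∀ (_ : L) (j : Fin N), Matrix (Fin (size j)) (Fin (size j)) ℝ
  y : Ω → ∀ (_ : L) (j : Fin N), Fin (size j) → ℝ
  sign : Ω → Fin B → Fin N → ℝ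

attribute [instance] ClusterExperiment.mΩ ClusterExperiment.isProb

namespace ClusterExperiment

variable {L : Type v} {q : L → ℕ} {B : ℕ} (E : ClusterExperiment.{u, v} L q B)

/-- The total number of observations per outcome. -/
def total : ℕ := ∑ j, E.size j

/-- The size of the largest cluster. -/
def maxSize : ℕ := Finset.univ.sup E.size

/-- The covariates of all outcomes in cluster `j`. -/
def covariates (j : Fin E.N) (ω : E.Ω) :
    (L → Fin (E.size j) → ℝ) × (∀ l : L, Fin (E.size j) → Fin (q l) → ℝ) :=
  (fun l => E.x ω l j, fun l => E.Z ω l j)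

/-- The responses of all outcomes in cluster `j`. -/
def responses (j : Fin E.N) (ω : E.Ω) : L → Fin (E.size j) → ℝ :=
  fun l => E.y ω l j

/-- The σ-algebra generated by the covariates of cluster `j`. -/
@[reducible] def clusterSigma (j : Fin E.N) : MeasurableSpace E.Ω :=
  MeasurableSpace.comap (E.covariates j) inferInstance

/-- The σ-algebra generated by the covariates of all clusters. -/
@[reducible] def designSigma : MeasurableSpace E.Ω := ⨆ j, E.clusterSigma j

/-- The covariate of interest, stacked over clusters. -/
def xStack (l : L) (ω : E.Ω) : (Σ j, Fin (E.size j)) → ℝ := fun p => E.x ω l p.1 p.2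

/-- The nuisance covariates, stacked over clusters. -/
def ZStack (l : L) (ω : E.Ω) : Matrix (Σ j, Fin (E.size j)) (Fin (q l)) ℝ :=
  Matrix.of fun p => E.Z ω l p.1 p.2

/-- The responses, stacked over clusters. -/
def yStack (l : L) (ω : E.Ω) : (Σ j, Fin (E.size j)) → ℝ := fun p => E.y ω l p.1 p.2

/-- Standing assumptions on data and signs. -/
structure Standing : Prop where
  measurable_covariates : ∀ j, Measurable (E.covariates j)
  measurable_responses : ∀ j, Measurable (E.responses j)
  measurable_sign : ∀ b j, Measurable fun ω => E.sign ω b j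
  /-- The weights are functions of the covariates (in particular, they may be constant). -/
  measurable_weight : ∀ l j i i', Measurable[E.designSigma] fun ω => E.W ω l j i i'
  /-- The weights are symmetric positive definite. -/
  weight_posDef : ∀ ω l j, (E.W ω l j).PosDef
  /-- The nuisance parameter can be profiled out. -/
  nonsingular : ∀ l, ∀ᵐ ω ∂E.P, IsUnit (nuisanceGram (E.ZStack l ω) (E.W ω l)).det
  /-- Clusters are independent. -/
  indep_clusters : iIndepFun (fun j ω => (E.covariates j ω, E.responses j ω)) E.P
  /-- The first transformation is the identity. -/
  sign_first : ∀ ω (b : Fin B) j, b.val = 0 → E.sign ω b j = 1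
  /-- The other transformations have uniform signs. -/
  sign_uniform : ∀ (b : Fin B) j, b.val ≠ 0 →
    E.P {ω | E.sign ω b j = 1} = 1 / 2 ∧ E.P {ω | E.sign ω b j = -1} = 1 / 2
  /-- Signs are independent over transformations and clusters. -/
  indep_sign : iIndepFun (fun (p : Fin B × Fin E.N) ω => E.sign ω p.1 p.2) E.P
  /-- Signs are independent of the data. -/
  indep_sign_data : IndepFun E.sign (fun ω j => (E.covariates j ω, E.responses j ω)) E.P

/-- `ζ_{jl}` at a nuisance value `γ`, under the hypothesised value `β₀ l`. -/
def zeta (β₀ : L → ℝ) (l : L) (γ : Fin (q l) → ℝ) (j : Fin E.N) (ω : E.Ω) : ℝ :=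
  clusterScore (E.xStack l ω) (E.ZStack l ω) (E.W ω l) (E.yStack l ω) (β₀ l) γ j

/-- The estimator `γ̂_l`. -/
def gammaHat (β₀ : L → ℝ) (l : L) (ω : E.Ω) : Fin (q l) → ℝ :=
  profiledNuisance (E.xStack l ω) (E.ZStack l ω) (E.W ω l) (E.yStack l ω) (β₀ l)

/-- The vector `(ζ_{jl})_l` at the true nuisance value. -/
def zetaVec (β₀ : L → ℝ) (γ : ∀ l, Fin (q l) → ℝ) (j : Fin E.N) (ω : E.Ω) :
    EuclideanSpace ℝ L :=
  WithLp.toLp 2 fun l => E.zeta β₀ l (γ l) j ω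

/-- The vector `(ζ_{jl})_l` at the estimated nuisance value. -/
def zetaHatVec (β₀ : L → ℝ) (j : Fin E.N) (ω : E.Ω) : EuclideanSpace ℝ L :=
  WithLp.toLp 2 fun l => E.zeta β₀ l (E.gammaHat β₀ l ω) j ω

/-- The sign-flipped score statistic `S_l(F_b) = n^{-1/2} ∑_j s_j^b ζ_{jl}` at the estimated
nuisance value; these are the entries of the matrix `M_n`. -/
def flippedScore (β₀ : L → ℝ) (b : Fin B) (l : L) (ω : E.Ω) : ℝ :=
  (√(E.total : ℝ))⁻¹ * ∑ j, E.sign ω b j * E.zeta β₀ l (E.gammaHat β₀ l ω) j ω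

/-- The conditional covariance of `f` and `g` given the covariates of all clusters. -/
def designCov (f g : E.Ω → ℝ) : E.Ω → ℝ :=
  E.P[(f - E.P[f | E.designSigma]) * (g - E.P[g | E.designSigma]) | E.designSigma]

end ClusterExperiment

/-! ### Convergence in probability over varying probability spaces -/

section Asymptotics

variable {L : Type v} {q : L → ℕ} {B : ℕ}

/-- `X k → c` in probability. -/
def TendstoInProb (E : ℕ → ClusterExperiment.{u, v} L q B) (X : ∀ k, (E k).Ω → ℝ) (c : ℝ) : Prop :=
  ∀ ε : ℝ, 0 < ε → Tendsto (fun k => (E k).P {ω | ε < |X k ω - c|}) atTop (𝓝 0)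

/-- `X k = O_p(1)`. -/
def BoundedInProb (E : ℕ → ClusterExperiment.{u, v} L q B) (X : ∀ k, (E k).Ω → ℝ) : Prop :=
  ∀ ε : ℝ≥0∞, 0 < ε → ∃ C : ℝ, ∀ᶠ k in atTop, (E k).P {ω | C < |X k ω|} ≤ ε

/-- The conditional mean of each response, given the covariates of its cluster, is
`x β + Z γ`. -/
def MeanModel (E : ℕ → ClusterExperiment.{u, v} L q B) (β : L → ℝ)
    (γ : ∀ l, Fin (q l) → ℝ) : Prop :=
  ∀ k l (j : Fin (E k).N) (i : Fin ((E k).size j)),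
    Integrable (fun ω => (E k).y ω l j i) (E k).P ∧
    (E k).P[fun ω => (E k).y ω l j i | (E k).clusterSigma j] =ᵐ[(E k).P]
      fun ω => (E k).x ω l j i * β l + ∑ a, (E k).Z ω l j i a * γ l a

/-- `max_j n_j / n → 0`. -/
def NegligibleClusters (E : ℕ → ClusterExperiment.{u, v} L q B) : Prop :=
  Tendsto (fun k => ((E k).maxSize : ℝ) / ((E k).total : ℝ)) atTop (𝓝 0)

/-- For some `d > 2`, `n^{-d/2} ∑_j 𝔼 ‖ζ_j‖^d → 0`. -/
def LyapunovCondition [Fintype L] (E : ℕ → ClusterExperiment.{u, v} L q B) (β₀ : L → ℝ)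
    (γ : ∀ l, Fin (q l) → ℝ) : Prop :=
  ∃ d : ℝ, 2 < d ∧
    Tendsto (fun k => ENNReal.ofReal (((E k).total : ℝ) ^ (-d / 2)) *
      ∑ j, ∫⁻ ω, ‖(E k).zetaVec β₀ γ j ω‖ₑ ^ d ∂(E k).P) atTop (𝓝 0)

/-- `n⁻¹ ∑_j Var(ζ_j | covariates) → Σ` in probability. For a nonrandom design this is the
convergence of the sequence of matrices `n⁻¹ ∑_j Var(ζ_j)`. -/
def CovarianceLimit (E : ℕ → ClusterExperiment.{u, v} L q B) (β₀ : L → ℝ)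
    (γ : ∀ l, Fin (q l) → ℝ) (S : Matrix L L ℝ) : Prop :=
  ∀ l l', TendstoInProb E
    (fun k ω => ((E k).total : ℝ)⁻¹ * ∑ j,
      (E k).designCov ((E k).zeta β₀ l (γ l) j) ((E k).zeta β₀ l' (γ l') j) ω) (S l l')

/-- For every `ε > 0`, `n⁻¹ ∑_j 𝔼 [‖ζ_j‖² ; ‖ζ_j‖ > ε √n] → 0`. -/
def LindebergCondition [Fintype L] (E : ℕ → ClusterExperiment.{u, v} L q B) (β₀ : L → ℝ)
    (γ : ∀ l, Fin (q l) → ℝ) : Prop :=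
  ∀ ε : ℝ, 0 < ε →
    Tendsto (fun k => ENNReal.ofReal (((E k).total : ℝ)⁻¹) *
      ∑ j, ∫⁻ ω in {ω | ε * √((E k).total : ℝ) < ‖(E k).zetaVec β₀ γ j ω‖},
        ‖(E k).zetaVec β₀ γ j ω‖ₑ ^ 2 ∂(E k).P) atTop (𝓝 0)

/-- There are deterministic rates `r_n → ∞` with `r_n ≤ √n`, common to all outcomes, such that
`r_n ‖γ̂_l - γ_l‖ = O_p(1)`. -/
def NuisanceRate (E : ℕ → ClusterExperiment.{u, v} L q B) (β₀ : L → ℝ)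
    (γ : ∀ l, Fin (q l) → ℝ) : Prop :=
  ∃ r : ℕ → ℝ, Tendsto r atTop atTop ∧ (∀ k, r k ≤ √((E k).total : ℝ)) ∧
    ∀ l, BoundedInProb E fun k ω =>
      r k * ‖(WithLp.toLp 2 ((E k).gammaHat β₀ l ω - γ l) : EuclideanSpace ℝ (Fin (q l)))‖

/-- `n^{-1/2} ∑_j ‖ζ_j(γ̂) - ζ_j(γ)‖ = o_p(1)`. -/
def NegligiblePlugIn [Fintype L] (E : ℕ → ClusterExperiment.{u, v} L q B) (β₀ : L → ℝ)
    (γ : ∀ l, Fin (q l) → ℝ) : Prop :=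
  TendstoInProb E (fun k ω => (√((E k).total : ℝ))⁻¹ *
    ∑ j, ‖(E k).zetaHatVec β₀ j ω - (E k).zetaVec β₀ γ j ω‖) 0

end Asymptotics

end

/-!
The characteristic function of the matrix of flipped scores is shown to converge pointwise to that
of a Gaussian matrix with independent rows; Lévy's theorem does the rest.

Fix coefficients `t`. By the plug-in condition, `∑ b, ∑ l, t b l * S_l(F_b)` may be replaced by the
same combination at the true nuisance value (`ClusterExperiment.Standing.ae_abs_flippedScore_sub_le`
and `norm_integral_cexp_sub_le`), which is a sum over clusters of `n^{-1/2}` times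
`ξ_j = ∑ b, ∑ l, t b l * s_j^b * ζ_{jl}`. The scores of different clusters are dependent, because
each of them involves the design of all clusters through the projection `H`. Conditionally on the
σ-algebra `D` of all covariates they are independent: the square roots of the weights cancel, so that
`ζ_{jl}` is a combination of the model errors of cluster `j` with `D`-measurable coefficients
(`ClusterExperiment.Standing.zeta_eq`). They are also conditionally centred, since the covariates of
the other clusters do not change the conditional mean of a response. The signs have mean zero (apart
from the first row, which is constant), are uncorrelated between rows and are independent of the
data; hence the conditional variance of `ξ_j` is a sum over `b` of quadratic forms in the conditional
covariances of the scores, without cross terms between rows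
(`ClusterExperiment.Standing.condExp_flippedCombo_sq`).

The core is a conditional central limit theorem, `norm_integral_cexp_sum_sub_le`. Conditional
independence enters only as the statement that `exp (i ξ_k)` is predicted from `D` and all other
clusters as well as from `D` alone (`condExp_sup_eq_condExp_sup`); no regular conditional
probabilities are needed. On a `D`-measurable event where the sum of the conditional variances is
close to its limit, `∏ exp (i ξ_k)` is compared with `∏ exp (-v_k / 2)`, where `v_k` is the
conditional variance, by telescoping the difference of the products and by a conditional Taylor
expansion of each factor. The Lindeberg condition makes the errors vanish, and provides the square
integrability that turns the conditional means and covariances into genuine ones.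

Positive semidefiniteness of the limit `S` holds because quadratic forms in conditional covariance
matrices are nonnegative almost surely and this persists under convergence in probability.
-/

noncomputable section

/-! ### Conditional expectations and independence -/

section CondExp

variable {Ω F : Type*}
  [NormedAddCommGroup F] [NormedSpace ℝ F] [CompleteSpace F]

/-- The σ-algebra `a ⊔ b` is generated by the π-system of sets `s ∩ t`, with `s` in `a` and
`t` in `b`; hence set integrals over such sets determine a conditional expectation given `a ⊔ b`. -/
theorem ae_eq_condExp_sup_of_forall_inter {a b m0 : MeasurableSpace Ω} {μ : Measure Ω}
    [IsProbabilityMeasure μ]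
    (ha : a ≤ m0) (hb : b ≤ m0) {f g : Ω → F} (hf : Integrable f μ) (hg : Integrable g μ)
    (hgm : StronglyMeasurable[a ⊔ b] g)
    (h : ∀ s t, MeasurableSet[a] s → MeasurableSet[b] t →
      ∫ x in s ∩ t, g x ∂μ = ∫ x in s ∩ t, f x ∂μ) :
    g =ᵐ[μ] μ[f | a ⊔ b] := by
  have hab : a ⊔ b ≤ m0 := sup_le ha hb
  have huniv : ∫ x, g x ∂μ = ∫ x, f x ∂μ := by
    simpa using h Set.univ Set.univ (@MeasurableSet.univ Ω a) (@MeasurableSet.univ Ω b)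
  refine ae_eq_condExp_of_forall_setIntegral_eq hab hf (fun _ _ _ => hg.integrableOn) ?_
    hgm.aestronglyMeasurable
  intro s hs _
  refine MeasurableSpace.induction_on_inter (m := a ⊔ b)
    (C := fun s _ => ∫ x in s, g x ∂μ = ∫ x in s, f x ∂μ)
    (s := Set.image2 (· ∩ ·) {s | MeasurableSet[a] s} {s | MeasurableSet[b] s}) ?_ ?_ ?_ ?_ ?_ ?_ s hs
  · refine le_antisymm (sup_le ?_ ?_) (MeasurableSpace.generateFrom_le ?_)
    · exact fun s hs => MeasurableSpace.measurableSet_generateFrom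
        ⟨s, hs, Set.univ, @MeasurableSet.univ Ω b, Set.inter_univ s⟩
    · exact fun s hs => MeasurableSpace.measurableSet_generateFrom
        ⟨Set.univ, @MeasurableSet.univ Ω a, s, hs, Set.univ_inter s⟩
    · rintro _ ⟨s, hs, t, ht, rfl⟩
      exact MeasurableSet.inter (m := a ⊔ b) (le_sup_left (b := b) _ hs) (le_sup_right (a := a) _ ht)
  · rintro _ ⟨s, hs, t, ht, rfl⟩ _ ⟨s', hs', t', ht', rfl⟩ _
    exact ⟨s ∩ s', hs.inter hs', t ∩ t', ht.inter ht', Set.inter_inter_inter_comm _ _ _ _⟩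
  · simp
  · rintro _ ⟨s, hs, t, ht, rfl⟩
    exact h s t hs ht
  · intro t ht hC
    have h1 := integral_add_compl (hab t ht) hg
    have h2 := integral_add_compl (hab t ht) hf
    rw [hC, huniv, ← h2] at h1
    exact add_left_cancel h1
  · intro u hd hu hC
    rw [integral_iUnion (fun i => hab _ (hu i)) hd hg.integrableOn,
      integral_iUnion (fun i => hab _ (hu i)) hd hf.integrableOn]
    exact tsum_congr hC

/-- Information independent of `f` and of the σ-algebra `a` does not change the
conditional expectation of `f` given `a`. -/
theorem condExp_sup_of_indep {a m₁ m₂ m0 : MeasurableSpace Ω} {μ : Measure Ω}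
    [IsProbabilityMeasure μ]
    (ha : a ≤ m₁) (h₁ : m₁ ≤ m0) (h₂ : m₂ ≤ m0) (hind : Indep m₁ m₂ μ) {f : Ω → F}
    (hf : Integrable f μ) (hfm : StronglyMeasurable[m₁] f) :
    μ[f | a ⊔ m₂] =ᵐ[μ] μ[f | a] := by
  have key : ∀ g : Ω → F, Integrable g μ → StronglyMeasurable[m₁] g → ∀ s t,
      MeasurableSet[a] s → MeasurableSet[m₂] t →
      ∫ x in s ∩ t, g x ∂μ = μ.real t • ∫ x in s, g x ∂μ := by
    intro g hg hgm s t hs ht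
    have hs0 : MeasurableSet s := h₁ _ (ha _ hs)
    have h := condExp_indep_eq (f := s.indicator g) h₁ h₂
      (hgm.indicator (ha _ hs)) hind
    rw [Set.inter_comm, ← setIntegral_indicator hs0,
      ← setIntegral_condExp h₂ (hg.indicator hs0) ht,
      setIntegral_congr_ae (h₂ _ ht) (h.mono fun x hx _ => hx), setIntegral_const,
      integral_indicator hs0]
  refine (ae_eq_condExp_sup_of_forall_inter (ha.trans h₁) h₂ hf integrable_condExp
    (stronglyMeasurable_condExp.mono le_sup_left) fun s t hs ht => ?_).symm
  rw [key _ hf hfm s t hs ht, key _ integrable_condExp (stronglyMeasurable_condExp.mono ha) s t hs ht,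
    setIntegral_condExp (ha.trans h₁) hf hs]

/-- Let `m₁` and `m₂` be independent, with sub-σ-algebras `a ≤ m₁` and `b ≤ m₂`. Then `m₁` and `m₂`
are conditionally independent given `a ⊔ b`: knowing all of `m₂` does not improve the prediction of
a function of `m₁` and `b`. -/
theorem condExp_sup_eq_condExp_sup {a b m₁ m₂ m0 : MeasurableSpace Ω} {μ : Measure Ω}
    [IsProbabilityMeasure μ]
    (ha : a ≤ m₁) (hb : b ≤ m₂) (h₁ : m₁ ≤ m0) (h₂ : m₂ ≤ m0) (hind : Indep m₁ m₂ μ) {f : Ω → F}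
    (hf : Integrable f μ) (hfm : StronglyMeasurable[b ⊔ m₁] f) :
    μ[f | a ⊔ m₂] =ᵐ[μ] μ[f | a ⊔ b] := by
  have hb1 : b ⊔ m₁ ≤ m0 := sup_le (hb.trans h₂) h₁
  have hab : a ⊔ b ≤ m0 := sup_le (ha.trans h₁) (hb.trans h₂)
  have hab1 : a ⊔ b ≤ b ⊔ m₁ := sup_le (ha.trans le_sup_right) le_sup_left
  -- Replace the indicator of a set of `m₂` by its conditional probability given `b`.
  have key : ∀ g : Ω → F, Integrable g μ → StronglyMeasurable[b ⊔ m₁] g → ∀ s t,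
      MeasurableSet[a] s → MeasurableSet[m₂] t →
      ∫ x in s ∩ t, g x ∂μ = ∫ x in s, (μ[t.indicator (fun _ => (1 : ℝ)) | b] • g) x ∂μ := by
    intro g hg hgm s t hs ht
    have hs0 : MeasurableSet s := h₁ _ (ha _ hs)
    have ht0 : MeasurableSet t := h₂ _ ht
    have hi : Integrable (t.indicator (fun _ => (1 : ℝ))) μ := (integrable_const 1).indicator ht0
    have hmul : t.indicator (fun _ => (1 : ℝ)) • g = t.indicator g := by
      ext x
      by_cases hx : x ∈ t <;> simp [hx]
    have hpull := condExp_smul_of_aestronglyMeasurable_right (m := b ⊔ m₁)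
      (f := t.indicator (fun _ => (1 : ℝ))) hi
      (by rw [hmul]; exact hg.indicator ht0) hgm.aestronglyMeasurable
    rw [hmul] at hpull
    have hA1 := condExp_sup_of_indep (a := b) (m₁ := m₂) (m₂ := m₁) hb h₂ h₁ hind.symm hi
      (stronglyMeasurable_const.indicator ht)
    rw [← setIntegral_indicator ht0,
      ← setIntegral_condExp hb1 (hg.indicator ht0) ((ha.trans le_sup_right) _ hs)]
    refine setIntegral_congr_ae hs0 ?_
    filter_upwards [hpull, hA1] with x hx hx' _
    rw [hx]
    simp [hx']
  refine (ae_eq_condExp_sup_of_forall_inter (ha.trans h₁) h₂ hf integrable_condExp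
    (stronglyMeasurable_condExp.mono (sup_le_sup_left hb a)) fun s t hs ht => ?_).symm
  have hcm : StronglyMeasurable[a ⊔ b] (μ[f | a ⊔ b]) := stronglyMeasurable_condExp
  rw [key _ integrable_condExp (hcm.mono hab1) s t hs ht, key _ hf hfm s t hs ht]
  have hp : StronglyMeasurable[a ⊔ b] (μ[t.indicator (fun _ => (1 : ℝ)) | b]) :=
    stronglyMeasurable_condExp.mono le_sup_right
  have hb01 : ∀ᵐ x ∂μ, |(μ[t.indicator (fun _ => (1 : ℝ)) | b]) x| ≤ 1 := by
    refine ae_bdd_abs_condExp_of_ae_bdd_abs (ae_of_all _ fun x => ?_)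
    by_cases hx : x ∈ t <;> simp [hx]
  have hint : Integrable (μ[t.indicator (fun _ => (1 : ℝ)) | b] • f) μ := by
    refine Integrable.bdd_smul hf 1 (hp.mono hab).aestronglyMeasurable ?_
    simpa using hb01
  have hpull := condExp_smul_of_aestronglyMeasurable_left (m := a ⊔ b) hp.aestronglyMeasurable
    hint hf
  rw [← setIntegral_condExp hab hint (le_sup_left (b := b) _ hs)]
  exact setIntegral_congr_ae (h₁ _ (ha _ hs)) (hpull.mono fun x hx _ => hx.symm)

/-- A factor `s` independent of `m₂` comes out of a conditional expectation given a
sub-σ-algebra of `m₂` as its mean. -/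
theorem condExp_mul_of_indep {a m₁ m₂ m0 : MeasurableSpace Ω} {μ : Measure Ω}
    [IsProbabilityMeasure μ]
    (ha : a ≤ m₂) (h₁ : m₁ ≤ m0) (h₂ : m₂ ≤ m0) (hind : Indep m₁ m₂ μ) {s g : Ω → ℝ}
    (hs : Integrable s μ) (hsm : StronglyMeasurable[m₁] s) (hgm : StronglyMeasurable[m₂] g)
    (hsg : Integrable (s * g) μ) :
    μ[s * g | a] =ᵐ[μ] fun ω => (∫ x, s x ∂μ) * (μ[g | a]) ω := by
  have e1 : μ[s * g | m₂] =ᵐ[μ] (∫ x, s x ∂μ) • g := by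
    refine (condExp_mul_of_stronglyMeasurable_right hgm hsg hs).trans ?_
    filter_upwards [condExp_indep_eq h₁ h₂ hsm hind] with x hx
    simp [hx]
  exact (condExp_condExp_of_le ha h₂).symm.trans
    ((condExp_congr_ae e1).trans (condExp_smul _ _ _))

/-- Two independent families of independent σ-algebras, taken together, are independent. -/
theorem iIndep_sumElim {ι κ : Type*} [Fintype ι] [Fintype κ] {m₁ : ι → MeasurableSpace Ω}
    {m₂ : κ → MeasurableSpace Ω} {m0 : MeasurableSpace Ω} {μ : Measure Ω}
    (hi₁ : iIndep m₁ μ) (hi₂ : iIndep m₂ μ)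
    (hind : Indep (⨆ i, m₁ i) (⨆ k, m₂ k) μ) : iIndep (Sum.elim m₁ m₂) μ := by
  classical
  rw [iIndep_iff] at hi₁ hi₂ ⊢
  intro s f hf
  have hs : (⋂ i ∈ s, f i) = (⋂ i ∈ s.toLeft, f (Sum.inl i)) ∩ ⋂ i ∈ s.toRight, f (Sum.inr i) := by
    ext x
    simp
  have hp : ∏ i ∈ s, μ (f i) =
      (∏ i ∈ s.toLeft, μ (f (Sum.inl i))) * ∏ i ∈ s.toRight, μ (f (Sum.inr i)) := by
    conv_lhs => rw [← Finset.toLeft_disjSum_toRight (u := s)]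
    rw [Finset.prod_disjSum]
  have hl : ∀ i ∈ s.toLeft, MeasurableSet[m₁ i] (f (Sum.inl i)) := fun i hi =>
    hf _ (Finset.mem_toLeft.1 hi)
  have hr : ∀ i ∈ s.toRight, MeasurableSet[m₂ i] (f (Sum.inr i)) := fun i hi =>
    hf _ (Finset.mem_toRight.1 hi)
  rw [hs, hp, ← hi₁ _ hl, ← hi₂ _ hr]
  rw [Indep_iff] at hind
  exact hind _ _
    (Finset.measurableSet_biInter _ fun i hi => le_iSup m₁ i _ (hl i hi))
    (Finset.measurableSet_biInter _ fun i hi => le_iSup m₂ i _ (hr i hi))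

end CondExp

/-! ### A conditional central limit theorem -/

section CondCLT

/-- Second-order Taylor bound for `exp (i x)` in the form suited to the Lindeberg condition. -/
theorem norm_cexp_mul_I_sub_le {ε : ℝ} (hε0 : 0 ≤ ε) (hε : ε ≤ 1) (x : ℝ) :
    ‖Complex.exp (x * Complex.I) - (1 + x * Complex.I - (x : ℂ) ^ 2 / 2)‖ ≤
      3 * ε * x ^ 2 + 4 * {y : ℝ | ε < |y|}.indicator (fun y => y ^ 2) x := by
  have hT : (1 + x * Complex.I - (x : ℂ) ^ 2 / 2) =
      ∑ m ∈ Finset.range 3, (x * Complex.I) ^ m / (m.factorial : ℂ) := by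
    simp [Finset.sum_range_succ, mul_pow, Nat.factorial]
    ring
  have hn : ‖(x : ℂ) * Complex.I‖ = |x| := by simp
  have hsmall : |x| ≤ 1 → ‖Complex.exp (x * Complex.I) - (1 + x * Complex.I - (x : ℂ) ^ 2 / 2)‖ ≤
      3 * |x| ^ 3 := by
    intro hx
    have h := Complex.norm_exp_sub_sum_le_norm_mul_exp (x * Complex.I) 3
    rw [← hT, hn] at h
    have he : Real.exp |x| ≤ 3 :=
      (Real.exp_le_exp.2 hx).trans (Real.exp_one_lt_d9.le.trans (by norm_num))
    nlinarith [pow_nonneg (abs_nonneg x) 3]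
  have hcube : |x| ^ 3 = |x| * x ^ 2 := by rw [← sq_abs x]; ring
  by_cases hx : ε < |x|
  · rw [Set.indicator_of_mem (show x ∈ {y : ℝ | ε < |y|} from hx)]
    have h0 : 0 ≤ 3 * ε * x ^ 2 := by positivity
    rcases le_or_gt (|x|) 1 with h | h
    · refine (hsmall h).trans ?_
      rw [hcube]
      nlinarith [sq_nonneg x]
    · have h1 : ‖(1 + x * Complex.I - (x : ℂ) ^ 2 / 2)‖ ≤ 1 + |x| + x ^ 2 / 2 := by
        refine (norm_sub_le _ _).trans (add_le_add ((norm_add_le _ _).trans ?_) ?_)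
        · simp
        · simp
      have h2 := norm_sub_le (Complex.exp (x * Complex.I)) (1 + x * Complex.I - (x : ℂ) ^ 2 / 2)
      rw [Complex.norm_exp_ofReal_mul_I] at h2
      have h3 := sq_abs x
      nlinarith
  · push Not at hx
    rw [Set.indicator_of_notMem (show x ∉ {y : ℝ | ε < |y|} from not_lt.2 hx)]
    refine (hsmall (hx.trans hε)).trans ?_
    rw [hcube]
    nlinarith [sq_nonneg x]

theorem abs_exp_neg_half_sub_le {v : ℝ} (hv : 0 ≤ v) :
    |Real.exp (-v / 2) - (1 - v / 2)| ≤ v ^ 2 := by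
  have h1 : 1 - v / 2 ≤ Real.exp (-v / 2) := by
    have := Real.add_one_le_exp (-v / 2)
    linarith
  rw [abs_of_nonneg (by linarith)]
  rcases le_or_gt v 2 with h | h
  · have := Real.norm_exp_sub_one_sub_id_le (x := -v / 2)
      (by rw [Real.norm_eq_abs, abs_le]; constructor <;> linarith)
    have h2 := (le_abs_self _).trans this
    rw [Real.norm_eq_abs, sq_abs] at h2
    nlinarith [sq_nonneg v]
  · have : Real.exp (-v / 2) ≤ 1 := Real.exp_le_one_iff.2 (by linarith)
    nlinarith

variable {Ω : Type*}

theorem condExp_ofReal {D m0 : MeasurableSpace Ω} {μ : Measure Ω} {f : Ω → ℝ}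
    (hf : Integrable f μ) :
    μ[fun ω => (f ω : ℂ) | D] =ᵐ[μ] fun ω => ((μ[f | D]) ω : ℂ) :=
  (Complex.ofRealCLM.comp_condExp_comm (m := D) hf).symm

/-- A conditionally centred variable has conditional characteristic function close to that of a
Gaussian with the same conditional variance. -/
theorem norm_condExp_cexp_sub_le {D m0 : MeasurableSpace Ω} {μ : Measure Ω}
    [IsProbabilityMeasure μ] (hD : D ≤ m0) {ξ : Ω → ℝ} (hξ : MemLp ξ 2 μ)
    (hmean : μ[ξ | D] =ᵐ[μ] 0) {ε : ℝ} (hε0 : 0 < ε) (hε : ε ≤ 1) :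
    ∀ᵐ ω ∂μ, ‖(μ[fun ω => Complex.exp (ξ ω * Complex.I) | D]) ω -
        (Real.exp (-(μ[fun ω => ξ ω ^ 2 | D]) ω / 2) : ℂ)‖ ≤
      3 * ε * (μ[fun ω => ξ ω ^ 2 | D]) ω +
        4 * (μ[fun ω => {y : ℝ | ε < |y|}.indicator (fun y => y ^ 2) (ξ ω) | D]) ω +
        (μ[fun ω => ξ ω ^ 2 | D]) ω *
          (ε ^ 2 + (μ[fun ω => {y : ℝ | ε < |y|}.indicator (fun y => y ^ 2) (ξ ω) | D]) ω) := by
  have hi : Integrable ξ μ := hξ.integrable one_le_two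
  have hi2 : Integrable (fun ω => ξ ω ^ 2) μ := hξ.integrable_sq
  have hS : MeasurableSet {y : ℝ | ε < |y|} := measurableSet_lt measurable_const measurable_abs
  set T : Ω → ℝ := fun ω => {y : ℝ | ε < |y|}.indicator (fun y => y ^ 2) (ξ ω) with hT
  have hTm : AEStronglyMeasurable T μ :=
    (((measurable_id.pow_const 2).indicator hS).comp_aemeasurable
      hi.aestronglyMeasurable.aemeasurable).aestronglyMeasurable
  have hT0 : ∀ ω, 0 ≤ T ω := fun ω => Set.indicator_nonneg (fun _ _ => sq_nonneg _) _
  have hTi : Integrable T μ := hi2.mono hTm (ae_of_all _ fun ω => by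
    rw [Real.norm_of_nonneg (hT0 ω), Real.norm_of_nonneg (sq_nonneg _)]
    exact Set.indicator_le_self' (fun _ _ => sq_nonneg _) _)
  have hem : AEStronglyMeasurable (fun ω => Complex.exp (ξ ω * Complex.I)) μ :=
    (by fun_prop : Continuous fun x : ℝ => Complex.exp (x * Complex.I)).comp_aestronglyMeasurable
      hi.aestronglyMeasurable
  have hei : Integrable (fun ω => Complex.exp (ξ ω * Complex.I)) μ :=
    Integrable.of_bound hem 1 (ae_of_all _ fun ω => by simp [Complex.norm_exp_ofReal_mul_I])
  have hic : Integrable (fun ω => (ξ ω : ℂ)) μ := hi.ofReal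
  have hi2c : Integrable (fun ω => ((ξ ω ^ 2 : ℝ) : ℂ)) μ := hi2.ofReal
  -- the conditional expectation of the Taylor polynomial
  have e1 : μ[fun ω => Complex.exp (ξ ω * Complex.I) -
        (1 + ξ ω * Complex.I - (ξ ω : ℂ) ^ 2 / 2) | D] =ᵐ[μ]
      fun ω => (μ[fun ω => Complex.exp (ξ ω * Complex.I) | D]) ω -
        (1 - ((μ[fun ω => ξ ω ^ 2 | D]) ω : ℂ) / 2) := by
    have hfun : (fun ω => Complex.exp (ξ ω * Complex.I) -
        (1 + ξ ω * Complex.I - (ξ ω : ℂ) ^ 2 / 2)) =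
        (fun ω => Complex.exp (ξ ω * Complex.I)) - ((fun _ => (1 : ℂ)) +
          Complex.I • (fun ω => (ξ ω : ℂ)) - (1 / 2 : ℂ) • fun ω => ((ξ ω ^ 2 : ℝ) : ℂ)) := by
      ext ω
      simp
      ring
    rw [hfun]
    have hp1 : Integrable ((fun _ => (1 : ℂ)) + Complex.I • (fun ω => (ξ ω : ℂ))) μ :=
      (integrable_const _).add (hic.smul _)
    filter_upwards [condExp_sub hei (hp1.sub (hi2c.smul (1 / 2 : ℂ))) D,
      condExp_sub hp1 (hi2c.smul (1 / 2 : ℂ)) D,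
      condExp_add (integrable_const (1 : ℂ)) (hic.smul Complex.I) D,
      condExp_smul (μ := μ) Complex.I (fun ω => (ξ ω : ℂ)) D,
      condExp_smul (μ := μ) (1 / 2 : ℂ) (fun ω => ((ξ ω ^ 2 : ℝ) : ℂ)) D,
      condExp_ofReal (D := D) hi, condExp_ofReal (D := D) hi2, hmean] with ω h1 h2 h3 h4 h5 h6 h7 h8
    rw [h1, Pi.sub_apply, h2, Pi.sub_apply, h3, Pi.add_apply, h4, h5, condExp_const hD]
    simp only [Pi.smul_apply, h6, h7, h8]
    simp
    ring
  have hbi : Integrable (fun ω => 3 * ε * ξ ω ^ 2 + 4 * T ω) μ :=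
    (hi2.const_mul _).add (hTi.const_mul _)
  have hri : Integrable (fun ω => Complex.exp (ξ ω * Complex.I) -
        (1 + ξ ω * Complex.I - (ξ ω : ℂ) ^ 2 / 2)) μ := by
    refine hbi.mono' ?_ (ae_of_all _ fun ω => norm_cexp_mul_I_sub_le hε0.le hε _)
    exact (by fun_prop : Continuous fun x : ℝ => Complex.exp (x * Complex.I) -
      (1 + x * Complex.I - (x : ℂ) ^ 2 / 2)).comp_aestronglyMeasurable hi.aestronglyMeasurable
  have e2 : μ[fun ω => 3 * ε * ξ ω ^ 2 + 4 * T ω | D] =ᵐ[μ]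
      fun ω => 3 * ε * (μ[fun ω => ξ ω ^ 2 | D]) ω + 4 * (μ[T | D]) ω := by
    filter_upwards [condExp_add (hi2.const_mul (3 * ε)) (hTi.const_mul 4) D,
      condExp_smul (μ := μ) (3 * ε) (fun ω => ξ ω ^ 2) D, condExp_smul (μ := μ) (4 : ℝ) T D]
      with ω h1 h2 h3
    exact h1.trans (congrArg₂ (· + ·) h2 h3)
  -- the conditional variance is small up to a tail term, which makes its square negligible
  have e3 : μ[fun ω => ξ ω ^ 2 | D] ≤ᵐ[μ] fun ω => ε ^ 2 + (μ[T | D]) ω := by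
    have hle : (fun ω => ξ ω ^ 2) ≤ᵐ[μ] (fun _ => ε ^ 2) + T := ae_of_all _ fun ω => by
      by_cases h : ε < |ξ ω|
      · simp [hT, h, sq_nonneg]
      · have : ξ ω ^ 2 ≤ ε ^ 2 := by
          rw [← sq_abs (ξ ω)]
          exact pow_le_pow_left₀ (abs_nonneg _) (not_lt.1 h) 2
        simpa [hT, h] using this
    filter_upwards [condExp_mono (m := D) hi2 ((integrable_const _).add hTi) hle,
      condExp_add (integrable_const (ε ^ 2)) hTi D] with ω h1 h2
    rw [h2, Pi.add_apply, condExp_const hD] at h1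
    exact h1
  have e4 : 0 ≤ᵐ[μ] μ[fun ω => ξ ω ^ 2 | D] :=
    condExp_nonneg (ae_of_all _ fun ω => sq_nonneg _)
  filter_upwards [e1, e2, e3, e4, norm_condExp_le (m := D) (μ := μ) (fun ω =>
    Complex.exp (ξ ω * Complex.I) - (1 + ξ ω * Complex.I - (ξ ω : ℂ) ^ 2 / 2)),
    condExp_mono (m := D) hri.norm hbi (ae_of_all _ fun ω => norm_cexp_mul_I_sub_le hε0.le hε _)]
    with ω h1 h2 h3 h4 h5 h6
  rw [h1] at h5
  rw [h2] at h6
  set v := (μ[fun ω => ξ ω ^ 2 | D]) ω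
  have hv : 0 ≤ v := h4
  have hreal : ‖((1 - (v : ℂ) / 2) - (Real.exp (-v / 2) : ℂ))‖ ≤ v ^ 2 := by
    have : ((1 - (v : ℂ) / 2) - (Real.exp (-v / 2) : ℂ)) =
        ((-(Real.exp (-v / 2) - (1 - v / 2)) : ℝ) : ℂ) := by
      push_cast; ring
    rw [this, Complex.norm_real, norm_neg]
    exact abs_exp_neg_half_sub_le hv
  calc _ = ‖((μ[fun ω => Complex.exp (ξ ω * Complex.I) | D]) ω - (1 - (v : ℂ) / 2)) +
        ((1 - (v : ℂ) / 2) - (Real.exp (-v / 2) : ℂ))‖ := by congr 1; ring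
    _ ≤ _ := norm_add_le _ _
    _ ≤ (3 * ε * v + 4 * (μ[T | D]) ω) + v ^ 2 := add_le_add (h5.trans h6) hreal
    _ ≤ _ := by nlinarith

/-- Telescoping comparison of a product of variables `U i`, conditionally independent given `D`,
with a product of `D`-measurable variables `V i`, on an event `A` of `D`. Conditional independence
is used in the form that `U k` is predicted from `D` and the other factors as well as from `D`. -/
theorem norm_setIntegral_prod_sub_prod_le {ι : Type*} [Fintype ι] [LinearOrder ι]
    {D : MeasurableSpace Ω} {G : ι → MeasurableSpace Ω} {m0 : MeasurableSpace Ω} {μ : Measure Ω}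
    [IsProbabilityMeasure μ] (hDG : ∀ k, D ≤ G k) (hG : ∀ k, G k ≤ m0) {U V : ι → Ω → ℂ}
    (hUm : ∀ i, StronglyMeasurable[m0] (U i))
    (hU : ∀ k j, j ≠ k → StronglyMeasurable[G k] (U j)) (hU1 : ∀ k ω, ‖U k ω‖ ≤ 1)
    (hV : ∀ k, StronglyMeasurable[D] (V k)) (hV1 : ∀ k, ∀ᵐ ω ∂μ, ‖V k ω‖ ≤ 1)
    (hcond : ∀ k, μ[U k | G k] =ᵐ[μ] μ[U k | D]) {A : Set Ω} (hA : MeasurableSet[D] A) :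
    ‖∫ ω in A, (∏ i, U i ω - ∏ i, V i ω) ∂μ‖ ≤
      ∑ k, ∫ ω in A, ‖(μ[U k | D]) ω - V k ω‖ ∂μ := by
  rcases isEmpty_or_nonempty ι with he | ⟨⟨k0⟩⟩
  · simp
  have hD : D ≤ m0 := (hDG k0).trans (hG k0)
  have hA0 : MeasurableSet[m0] A := hD _ hA
  have hVm : ∀ k, StronglyMeasurable[m0] (V k) := fun k => (hV k).mono hD
  have hV1' : ∀ᵐ ω ∂μ, ∀ k, ‖V k ω‖ ≤ 1 := ae_all_iff.2 hV1
  have hUi : ∀ k, Integrable (U k) μ := fun k =>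
    Integrable.of_bound (hUm k).aestronglyMeasurable 1 (ae_of_all _ (hU1 k))
  have hVi : ∀ k, Integrable (V k) μ := fun k =>
    Integrable.of_bound (hVm k).aestronglyMeasurable 1 (hV1 k)
  set P : ι → Ω → ℂ := fun k ω =>
    (∏ j with j < k, U j ω) * ∏ j with k < j, V j ω with hP
  set W : ι → Ω → ℂ := fun k => A.indicator (P k) with hW
  have hPG : ∀ k, StronglyMeasurable[G k] (P k) := by
    intro k
    refine StronglyMeasurable.mul ?_ ?_
    · exact Finset.stronglyMeasurable_fun_prod _ fun j hj =>
        hU k j (Finset.mem_filter.1 hj).2.ne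
    · exact Finset.stronglyMeasurable_fun_prod _ fun j hj => (hV j).mono (hDG k)
  have hWG : ∀ k, StronglyMeasurable[G k] (W k) := fun k => (hPG k).indicator (hDG k _ hA)
  have hW1 : ∀ k, ∀ᵐ ω ∂μ, ‖W k ω‖ ≤ A.indicator (fun _ => (1 : ℝ)) ω := by
    intro k
    filter_upwards [hV1'] with ω hω
    by_cases h : ω ∈ A
    · simp only [hW, h, Set.indicator_of_mem, hP, norm_mul, norm_prod]
      refine mul_le_one₀ (Finset.prod_le_one (fun _ _ => norm_nonneg _) fun j _ => hU1 j ω)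
        (Finset.prod_nonneg fun _ _ => norm_nonneg _)
        (Finset.prod_le_one (fun _ _ => norm_nonneg _) fun j _ => hω j)
    · simp [hW, h]
  have hW1' : ∀ k, ∀ᵐ ω ∂μ, ‖W k ω‖ ≤ 1 := fun k => (hW1 k).mono fun ω h => h.trans (by
    by_cases h : ω ∈ A <;> simp [h])
  have hdi : ∀ k, Integrable (U k - V k) μ := fun k => (hUi k).sub (hVi k)
  have hWi : ∀ k, Integrable (fun ω => W k ω * (U k - V k) ω) μ := fun k =>
    (hdi k).bdd_mul ((hWG k).mono (hG k)).aestronglyMeasurable (hW1' k)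
  have htel : ∀ ω, A.indicator (fun ω => ∏ i, U i ω - ∏ i, V i ω) ω =
      ∑ k, W k ω * (U k - V k) ω := by
    intro ω
    by_cases h : ω ∈ A
    · have hs := Finset.prod_sub_ordered (Finset.univ : Finset ι) (fun i => V i ω)
        (fun i => V i ω - U i ω)
      simp only [sub_sub_cancel] at hs
      simp only [hW, h, Set.indicator_of_mem, hs, hP, Pi.sub_apply]
      rw [sub_sub_cancel_left, ← Finset.sum_neg_distrib]
      refine Finset.sum_congr rfl fun k _ => ?_
      ring
    · simp [hW, h]
  rw [← integral_indicator hA0, integral_congr_ae (ae_of_all _ htel),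
    integral_finsetSum _ fun k _ => hWi k]
  refine (norm_sum_le _ _).trans (Finset.sum_le_sum fun k _ => ?_)
  -- condition on `G k`: all factors but the `k`-th are known, and `U k` is predicted from `D` alone
  have hpull : μ[fun ω => W k ω * (U k - V k) ω | G k] =ᵐ[μ]
      fun ω => W k ω * (μ[U k - V k | G k]) ω :=
    condExp_bilin_of_aestronglyMeasurable_left (ContinuousLinearMap.mul ℝ ℂ)
      (hWG k).aestronglyMeasurable (hWi k) (hdi k)
  rw [← integral_condExp (hG k), ← integral_indicator hA0]
  refine norm_integral_le_of_norm_le ((integrable_condExp.sub (hVi k)).norm.indicator hA0) ?_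
  filter_upwards [hpull, hW1 k, condExp_sub (hUi k) (hVi k) (G k), hcond k] with ω h1 h2 h3 h4
  rw [h1, h3, Pi.sub_apply, h4,
    condExp_of_stronglyMeasurable (hG k) ((hV k).mono (hDG k)) (hVi k), norm_mul]
  by_cases h : ω ∈ A
  · simp only [h, Set.indicator_of_mem] at h2 ⊢
    exact mul_le_of_le_one_left (norm_nonneg _) h2
  · simp [hW, h]

theorem abs_exp_neg_half_sub_exp_le {a b : ℝ} (ha : 0 ≤ a) (hb : 0 ≤ b) :
    |Real.exp (-a / 2) - Real.exp (-b / 2)| ≤ min 1 |a - b| := by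
  have key : ∀ {a b : ℝ}, 0 ≤ a → a ≤ b →
      |Real.exp (-a / 2) - Real.exp (-b / 2)| ≤ min 1 |a - b| := by
    intro a b ha hab
    have h1 : Real.exp (-b / 2) ≤ Real.exp (-a / 2) := Real.exp_le_exp.2 (by linarith)
    have h2 : Real.exp (-a / 2) ≤ 1 := Real.exp_le_one_iff.2 (by linarith)
    have h3 := Real.exp_pos (-b / 2)
    rw [abs_of_nonneg (by linarith), abs_sub_comm, abs_of_nonneg (by linarith : 0 ≤ b - a)]
    refine le_min (by linarith) ?_
    have h4 : Real.exp (-b / 2) = Real.exp (-a / 2) * Real.exp (-((b - a) / 2)) := by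
      rw [← Real.exp_add]; congr 1; ring
    have h5 := Real.add_one_le_exp (-((b - a) / 2))
    have h6 := Real.exp_pos (-a / 2)
    rw [h4]
    nlinarith
  rcases le_total a b with h | h
  · exact key ha h
  · rw [abs_sub_comm, abs_sub_comm a]
    exact key hb h

/-- Quantitative conditional central limit theorem: the distance at a point between the
characteristic function of a sum of conditionally independent, conditionally centred variables and
that of a Gaussian with variance `s` is controlled by the Lindeberg sum and by the deviation of the
sum of the conditional variances from `s`. -/
theorem norm_integral_cexp_sum_sub_le {ι : Type*} [Fintype ι] [LinearOrder ι]
    {D : MeasurableSpace Ω} {G : ι → MeasurableSpace Ω} {m0 : MeasurableSpace Ω} {μ : Measure Ω}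
    [IsProbabilityMeasure μ] (hD : D ≤ m0) (hDG : ∀ k, D ≤ G k) (hG : ∀ k, G k ≤ m0)
    {ξ : ι → Ω → ℝ} (hξm : ∀ i, Measurable (ξ i))
    (hξG : ∀ k j, j ≠ k → Measurable[G k] (ξ j)) (hξ : ∀ i, MemLp (ξ i) 2 μ)
    (hmean : ∀ i, μ[ξ i | D] =ᵐ[μ] 0)
    (hcond : ∀ k, μ[fun ω => Complex.exp (ξ k ω * Complex.I) | G k] =ᵐ[μ]
      μ[fun ω => Complex.exp (ξ k ω * Complex.I) | D])
    {s ε δ : ℝ} (hs : 0 ≤ s) (hε0 : 0 < ε) (hε : ε ≤ 1) (hδ0 : 0 < δ) (hδ : δ ≤ 1) :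
    ‖∫ ω, Complex.exp ((∑ i, ξ i ω : ℝ) * Complex.I) ∂μ - Real.exp (-s / 2)‖ ≤
      4 * ε * (s + 1) +
        (s + 5) * ∑ i, ∫ ω, {y : ℝ | ε < |y|}.indicator (fun y => y ^ 2) (ξ i ω) ∂μ +
        δ + 3 * μ.real {ω | δ < |∑ i, (μ[fun ω => ξ i ω ^ 2 | D]) ω - s|} := by
  set v : ι → Ω → ℝ := fun i => μ[fun ω => ξ i ω ^ 2 | D] with hv
  set T : ι → Ω → ℝ := fun i =>
    μ[fun ω => {y : ℝ | ε < |y|}.indicator (fun y => y ^ 2) (ξ i ω) | D] with hT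
  set U : ι → Ω → ℂ := fun i ω => Complex.exp (ξ i ω * Complex.I) with hU
  set V : ι → Ω → ℂ := fun i ω => (Real.exp (-v i ω / 2) : ℂ) with hV
  set A : Set Ω := {ω | |∑ i, v i ω - s| ≤ δ} with hAdef
  have hvm : ∀ i, Measurable[D] (v i) := fun i => stronglyMeasurable_condExp.measurable
  have hsumm : Measurable[D] fun ω => ∑ i, v i ω := Finset.measurable_fun_sum _ fun i _ => hvm i
  have hA : MeasurableSet[D] A :=
    measurableSet_le (α := ℝ) (measurable_abs.comp (hsumm.sub_const s)) measurable_const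
  have hAc : Aᶜ = {ω | δ < |∑ i, v i ω - s|} := by
    ext ω
    simp [hAdef]
  have hv0 : ∀ᵐ ω ∂μ, ∀ i, 0 ≤ v i ω := ae_all_iff.2 fun i =>
    condExp_nonneg (ae_of_all _ fun ω => sq_nonneg _)
  have hT0 : ∀ᵐ ω ∂μ, ∀ i, 0 ≤ T i ω := ae_all_iff.2 fun i =>
    condExp_nonneg (ae_of_all _ fun ω => Set.indicator_nonneg (fun _ _ => sq_nonneg _) _)
  have hcexp : Measurable fun x : ℝ => Complex.exp (x * Complex.I) :=
    (by fun_prop : Continuous fun x : ℝ => Complex.exp (x * Complex.I)).measurable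
  have hUm : ∀ i, Measurable (U i) := fun i => hcexp.comp (hξm i)
  have hVm : ∀ i, Measurable[D] (V i) := fun i =>
    (by fun_prop : Continuous fun x : ℝ => (Real.exp (-x / 2) : ℂ)).measurable.comp (hvm i)
  have hU1 : ∀ i ω, ‖U i ω‖ = 1 := fun i ω => Complex.norm_exp_ofReal_mul_I _
  have hV1 : ∀ᵐ ω ∂μ, ∀ i, ‖V i ω‖ ≤ 1 := by
    filter_upwards [hv0] with ω h i
    rw [hV, Complex.norm_real, Real.norm_of_nonneg (Real.exp_pos _).le]
    exact Real.exp_le_one_iff.2 (by linarith [h i])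
  have hprodV : ∀ ω, ∏ i, V i ω = (Real.exp (-(∑ i, v i ω) / 2) : ℂ) := by
    intro ω
    rw [hV]
    push_cast
    rw [← Complex.exp_sum]
    congr 1
    rw [← Finset.sum_div, ← Finset.sum_neg_distrib]
  have hprodU : ∀ ω, ∏ i, U i ω = Complex.exp ((∑ i, ξ i ω : ℝ) * Complex.I) := by
    intro ω
    rw [hU, ← Complex.exp_sum]
    congr 1
    push_cast
    rw [Finset.sum_mul]
  have hPU : Integrable (fun ω => ∏ i, U i ω) μ :=
    Integrable.of_bound (Finset.measurable_fun_prod _ fun i _ => hUm i).aestronglyMeasurable 1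
      (ae_of_all _ fun ω => by simp [norm_prod, hU1])
  have hPV1 : ∀ᵐ ω ∂μ, ‖∏ i, V i ω‖ ≤ 1 := by
    filter_upwards [hV1] with ω h
    rw [norm_prod]
    exact Finset.prod_le_one (fun _ _ => norm_nonneg _) fun i _ => h i
  have hPV : Integrable (fun ω => ∏ i, V i ω) μ :=
    Integrable.of_bound (Finset.measurable_fun_prod _ fun i _ =>
      (hVm i).mono hD le_rfl).aestronglyMeasurable 1 hPV1
  -- comparison of the two products on `A`
  have hmain : ‖∫ ω in A, (∏ i, U i ω - ∏ i, V i ω) ∂μ‖ ≤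
      4 * ε * (s + 1) +
        (s + 5) * ∑ i, ∫ ω, {y : ℝ | ε < |y|}.indicator (fun y => y ^ 2) (ξ i ω) ∂μ := by
    refine (norm_setIntegral_prod_sub_prod_le (D := D) (G := G) hDG hG
      (fun i => (hUm i).stronglyMeasurable)
      (fun k j hjk => (hcexp.comp (hξG k j hjk)).stronglyMeasurable) (fun k ω => (hU1 k ω).le)
      (fun k => (hVm k).stronglyMeasurable) (fun k => hV1.mono fun ω h => h k) hcond hA).trans ?_
    have hVi : ∀ k, Integrable (V k) μ := fun k => Integrable.of_bound
      ((hVm k).mono hD le_rfl).aestronglyMeasurable 1 (hV1.mono fun ω h => h k)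
    have hdi : ∀ k, Integrable (fun ω => ‖(μ[U k | D]) ω - V k ω‖) μ := fun k =>
      (integrable_condExp.sub (hVi k)).norm
    have hTi : Integrable (fun ω => ∑ k, T k ω) μ :=
      integrable_finsetSum _ fun k _ => integrable_condExp
    have hbi : Integrable (fun ω => 4 * ε * (s + 1) + (s + 5) * ∑ k, T k ω) μ :=
      (integrable_const _).add (hTi.const_mul _)
    have hptw : ∀ᵐ ω ∂μ, ω ∈ A → ∑ k, ‖(μ[U k | D]) ω - V k ω‖ ≤
        4 * ε * (s + 1) + (s + 5) * ∑ k, T k ω := by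
      filter_upwards [ae_all_iff.2 fun k => norm_condExp_cexp_sub_le hD (hξ k) (hmean k) hε0 hε,
        hv0, hT0] with ω h1 h2 h3 hωA
      have hsum : ∑ k, v k ω ≤ s + 1 := by
        have := (abs_le.1 (show |∑ i, v i ω - s| ≤ δ from hωA)).2
        linarith
      have hvk : ∀ k, v k ω ≤ s + 1 := fun k =>
        (Finset.single_le_sum (fun i _ => h2 i) (Finset.mem_univ k)).trans hsum
      have hsum0 : 0 ≤ ∑ k, v k ω := Finset.sum_nonneg fun i _ => h2 i
      calc ∑ k, ‖(μ[U k | D]) ω - V k ω‖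
          ≤ ∑ k, (4 * ε * v k ω + (s + 5) * T k ω) := Finset.sum_le_sum fun k _ => by
            refine (h1 k).trans ?_
            have a1 := h2 k
            have a2 := h3 k
            have a3 := hvk k
            change 3 * ε * v k ω + 4 * T k ω + v k ω * (ε ^ 2 + T k ω) ≤ _
            have a4 : ε ^ 2 * v k ω ≤ ε * v k ω :=
              mul_le_mul_of_nonneg_right (by nlinarith) a1
            have a5 : v k ω * T k ω ≤ (s + 1) * T k ω := mul_le_mul_of_nonneg_right a3 a2
            nlinarith
        _ = 4 * ε * ∑ k, v k ω + (s + 5) * ∑ k, T k ω := by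
            rw [Finset.sum_add_distrib, Finset.mul_sum, Finset.mul_sum]
        _ ≤ _ := by gcongr
    have hTint : ∫ ω, ∑ k, T k ω ∂μ =
        ∑ k, ∫ ω, {y : ℝ | ε < |y|}.indicator (fun y => y ^ 2) (ξ k ω) ∂μ := by
      rw [integral_finsetSum _ fun k _ => integrable_condExp]
      exact Finset.sum_congr rfl fun k _ => integral_condExp hD
    rw [← integral_finsetSum _ fun k _ => (hdi k).integrableOn, ← hTint]
    calc ∫ ω in A, ∑ k, ‖(μ[U k | D]) ω - V k ω‖ ∂μ
        ≤ ∫ ω in A, (4 * ε * (s + 1) + (s + 5) * ∑ k, T k ω) ∂μ := by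
          refine setIntegral_mono_on_ae (integrable_finsetSum _ fun k _ => hdi k).integrableOn
            hbi.integrableOn (hD _ hA) hptw
      _ ≤ ∫ ω, (4 * ε * (s + 1) + (s + 5) * ∑ k, T k ω) ∂μ := by
          refine setIntegral_le_integral hbi ?_
          filter_upwards [hT0] with ω h
          have : 0 ≤ ∑ k, T k ω := Finset.sum_nonneg fun k _ => h k
          simp only [Pi.zero_apply]
          positivity
      _ = _ := by
          rw [integral_add (integrable_const _) (hTi.const_mul _),
            integral_const_mul (s + 5)]
          simp
  -- off `A` both products are bounded by one
  have hoff : ‖∫ ω in Aᶜ, (∏ i, U i ω - ∏ i, V i ω) ∂μ‖ ≤ 2 * μ.real Aᶜ := by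
    refine norm_setIntegral_le_of_norm_le_const_ae' (measure_lt_top _ _) ?_
    filter_upwards [hPV1] with ω h _
    refine (norm_sub_le _ _).trans ?_
    have : ‖∏ i, U i ω‖ = 1 := by simp [norm_prod, hU1]
    linarith
  have hgauss : ‖∫ ω, ∏ i, V i ω ∂μ - (Real.exp (-s / 2) : ℂ)‖ ≤ δ + μ.real Aᶜ := by
    have h1 : ∫ ω, ∏ i, V i ω ∂μ - (Real.exp (-s / 2) : ℂ) =
        ∫ ω, (∏ i, V i ω - (Real.exp (-s / 2) : ℂ)) ∂μ := by
      rw [integral_sub hPV (integrable_const _)]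
      simp
    rw [h1]
    have hAc0 : MeasurableSet Aᶜ := (hD _ hA).compl
    have hbd : Integrable (fun ω => δ + Aᶜ.indicator (fun _ => (1 : ℝ)) ω) μ :=
      (integrable_const _).add ((integrable_const _).indicator hAc0)
    refine (norm_integral_le_of_norm_le hbd ?_).trans_eq ?_
    · filter_upwards [hv0] with ω h
      rw [hprodV, ← Complex.ofReal_sub, Complex.norm_real, Real.norm_eq_abs]
      have h2 := abs_exp_neg_half_sub_exp_le (Finset.sum_nonneg fun i _ => h i) hs
        (a := ∑ i, v i ω)
      by_cases hω : ω ∈ A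
      · have : |∑ i, v i ω - s| ≤ δ := hω
        simpa [hω] using h2.trans ((min_le_right _ _).trans this)
      · have h3 := h2.trans (min_le_left _ _)
        have : ω ∈ Aᶜ := hω
        rw [Set.indicator_of_mem this]
        linarith
    · rw [integral_add (integrable_const _) ((integrable_const _).indicator hAc0),
        integral_indicator hAc0]
      simp [measureReal_def]
  have hsplit : ∫ ω, Complex.exp ((∑ i, ξ i ω : ℝ) * Complex.I) ∂μ - Real.exp (-s / 2) =
      (∫ ω in A, (∏ i, U i ω - ∏ i, V i ω) ∂μ + ∫ ω in Aᶜ, (∏ i, U i ω - ∏ i, V i ω) ∂μ) +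
        (∫ ω, ∏ i, V i ω ∂μ - (Real.exp (-s / 2) : ℂ)) := by
    have h := integral_add_compl (hD _ hA) (hPU.sub hPV)
    simp only [Pi.sub_apply] at h
    rw [h, integral_sub hPU hPV]
    simp only [hprodU]
    ring
  rw [hsplit, ← hAc]
  refine (norm_add_le _ _).trans ((add_le_add ((norm_add_le _ _).trans
    (add_le_add hmain hoff)) hgauss).trans_eq ?_)
  ring

end CondCLT

/-! ### The algebra and the measurability of the scores -/

section ScoreAlgebra

variable {N : ℕ} {m : Fin N → ℕ} {q : ℕ}

theorem blockDiagonal'_mulVec_apply (M : ∀ j, Matrix (Fin (m j)) (Fin (m j)) ℝ)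
    (u : (Σ j, Fin (m j)) → ℝ) (j : Fin N) (i : Fin (m j)) :
    (Matrix.blockDiagonal' M *ᵥ u) ⟨j, i⟩ = (M j *ᵥ fun i' => u ⟨j, i'⟩) i := by
  simp only [Matrix.mulVec, dotProduct]
  rw [Fintype.sum_sigma, Finset.sum_eq_single j]
  · simp
  · intro j' _ hj
    exact Finset.sum_eq_zero fun i' _ => by
      rw [Matrix.blockDiagonal'_apply_ne _ _ _ hj.symm, zero_mul]
  · simp

theorem sqrtWeight_eq_blockDiagonal' {W : ∀ j, Matrix (Fin (m j)) (Fin (m j)) ℝ}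
    (hW : ∀ j, (W j).PosDef) :
    sqrtWeight W = Matrix.blockDiagonal' fun j => CFC.sqrt (W j) := by
  have hsq : ∀ {a : ∀ j, Matrix (Fin (m j)) (Fin (m j)) ℝ}, (∀ j, 0 ≤ a j) →
      Matrix.blockDiagonal' (fun j => CFC.sqrt (a j)) *
        Matrix.blockDiagonal' (fun j => CFC.sqrt (a j)) = Matrix.blockDiagonal' a := by
    intro a ha
    rw [← Matrix.blockDiagonal'_mul]
    congr 1
    ext1 j
    exact CFC.sqrt_mul_sqrt_self (a j) (ha j)
  refine CFC.sqrt_unique (hsq fun j => (hW j).posSemidef.nonneg) ?_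
  -- a block diagonal matrix with nonnegative blocks is a square of a symmetric matrix
  have h0 : ∀ j, 0 ≤ CFC.sqrt (W j) := fun j => CFC.sqrt_nonneg _
  have hsymm : (Matrix.blockDiagonal' fun j => CFC.sqrt (CFC.sqrt (W j)))ᴴ =
      Matrix.blockDiagonal' fun j => CFC.sqrt (CFC.sqrt (W j)) := by
    rw [Matrix.blockDiagonal'_conjTranspose]
    congr 1
    ext1 j
    exact (Matrix.nonneg_iff_posSemidef.1 (CFC.sqrt_nonneg (CFC.sqrt (W j)))).1
  rw [← hsq h0, Matrix.nonneg_iff_posSemidef]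
  nth_rewrite 1 [← hsymm]
  exact Matrix.posSemidef_conjTranspose_mul_self _

/-- The coefficient of the weighted least-squares regression of `x` on the nuisance covariates. -/
def regressionCoef (x : (Σ j, Fin (m j)) → ℝ) (Z : Matrix (Σ j, Fin (m j)) (Fin q) ℝ)
    (W : ∀ j, Matrix (Fin (m j)) (Fin (m j)) ℝ) : Fin q → ℝ :=
  (nuisanceGram Z W)⁻¹ *ᵥ (Zᵀ *ᵥ (blockWeight W *ᵥ x))

/-- The square roots of the weights cancel from the cluster scores: a cluster score is a
`W j`-inner product of the residual of `x` after regression on `Z` with the model error. -/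
theorem clusterScore_eq (x : (Σ j, Fin (m j)) → ℝ) (Z : Matrix (Σ j, Fin (m j)) (Fin q) ℝ)
    {W : ∀ j, Matrix (Fin (m j)) (Fin (m j)) ℝ} (hW : ∀ j, (W j).PosDef)
    (y : (Σ j, Fin (m j)) → ℝ) (β₀ : ℝ) (γ : Fin q → ℝ) (j : Fin N) :
    clusterScore x Z W y β₀ γ j =
      ∑ i, ∑ i', (x - Z *ᵥ regressionCoef x Z W) ⟨j, i⟩ * W j i i' *
        (y - (β₀ • x + Z *ᵥ γ)) ⟨j, i'⟩ := by
  have hR : sqrtWeight W * sqrtWeight W = blockWeight W := by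
    rw [sqrtWeight_eq_blockDiagonal' hW, ← Matrix.blockDiagonal'_mul, blockWeight]
    congr 1
    ext1 j
    exact CFC.sqrt_mul_sqrt_self (W j) (hW j).posSemidef.nonneg
  have hx : (1 - hatMatrix Z W) *ᵥ (sqrtWeight W *ᵥ x) =
      sqrtWeight W *ᵥ (x - Z *ᵥ regressionCoef x Z W) := by
    rw [Matrix.sub_mulVec, Matrix.one_mulVec, Matrix.mulVec_sub, hatMatrix, regressionCoef, ← hR]
    simp only [Matrix.mulVec_mulVec, Matrix.mul_assoc]
  have hsym : (CFC.sqrt (W j))ᵀ = CFC.sqrt (W j) := by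
    have := (Matrix.nonneg_iff_posSemidef.1 (CFC.sqrt_nonneg (W j))).1
    rwa [Matrix.IsHermitian, Matrix.conjTranspose_eq_transpose_of_trivial] at this
  rw [clusterScore, hx]
  generalize x - Z *ᵥ regressionCoef x Z W = u
  generalize y - (β₀ • x + Z *ᵥ γ) = r
  rw [sqrtWeight_eq_blockDiagonal' hW]
  simp only [blockDiagonal'_mulVec_apply]
  change (CFC.sqrt (W j) *ᵥ fun i' => u ⟨j, i'⟩) ⬝ᵥ (CFC.sqrt (W j) *ᵥ fun i' => r ⟨j, i'⟩) = _
  rw [dotProduct_comm, Matrix.dotProduct_mulVec, ← Matrix.mulVec_transpose, hsym, Matrix.mulVec_mulVec,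
    CFC.sqrt_mul_sqrt_self (W j) (hW j).posSemidef.nonneg, dotProduct_comm]
  simp only [dotProduct, Matrix.mulVec, Finset.mul_sum, mul_assoc]

end ScoreAlgebra

section Measurability

variable {Ω : Type*} [MeasurableSpace Ω]

theorem measurable_matrix_det {n : Type*} [Fintype n] [DecidableEq n] {M : Ω → Matrix n n ℝ}
    (hM : ∀ i j, Measurable fun ω => M ω i j) : Measurable fun ω => (M ω).det := by
  simp only [Matrix.det_apply]
  exact Finset.measurable_fun_sum _ fun σ _ =>
    (Finset.measurable_fun_prod _ fun i _ => hM _ _).const_smul _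

theorem measurable_matrix_inv {n : Type*} [Fintype n] [DecidableEq n] {M : Ω → Matrix n n ℝ}
    (hM : ∀ i j, Measurable fun ω => M ω i j) (i j : n) : Measurable fun ω => (M ω)⁻¹ i j := by
  simp only [Matrix.inv_def, Matrix.smul_apply, Matrix.adjugate_apply, Ring.inverse_eq_inv',
    smul_eq_mul]
  refine (measurable_matrix_det hM).inv.mul (measurable_matrix_det fun i' j' => ?_)
  by_cases h : i' = j
  · subst h
    simp
  · simpa [Matrix.updateRow_ne h] using hM i' j'

theorem measurable_matrix_mulVec {k n : Type*} [Fintype n] {M : Ω → Matrix k n ℝ} {u : Ω → n → ℝ}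
    (hM : ∀ i j, Measurable fun ω => M ω i j) (hu : ∀ j, Measurable fun ω => u ω j) (i : k) :
    Measurable fun ω => (M ω *ᵥ u ω) i :=
  Finset.measurable_fun_sum _ fun j _ => (hM i j).mul (hu j)

theorem measurable_matrix_mul {k n p : Type*} [Fintype n] {M : Ω → Matrix k n ℝ}
    {M' : Ω → Matrix n p ℝ} (hM : ∀ i j, Measurable fun ω => M ω i j)
    (hM' : ∀ i j, Measurable fun ω => M' ω i j) (i : k) (j : p) :
    Measurable fun ω => (M ω * M' ω) i j := by
  simp only [Matrix.mul_apply]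
  exact Finset.measurable_fun_sum _ fun a _ => (hM i a).mul (hM' a j)

variable {N : ℕ} {m : Fin N → ℕ} {q : ℕ}
  {Z : Ω → Matrix (Σ j, Fin (m j)) (Fin q) ℝ} {W : Ω → ∀ j, Matrix (Fin (m j)) (Fin (m j)) ℝ}

theorem measurable_blockWeight (hW : ∀ j i i', Measurable fun ω => W ω j i i')
    (p p' : Σ j, Fin (m j)) : Measurable fun ω => blockWeight (W ω) p p' := by
  obtain ⟨j, i⟩ := p
  obtain ⟨j', i'⟩ := p'
  by_cases h : j = j'
  · subst h
    simpa [blockWeight] using hW j i i'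
  · simp [blockWeight, Matrix.blockDiagonal'_apply_ne _ _ _ h]

/-- The regression coefficient on the nuisance covariates is measurable in the data, for whichever
σ-algebra the data are measurable. -/
theorem measurable_regressionCoef {x : Ω → (Σ j, Fin (m j)) → ℝ}
    (hx : ∀ p, Measurable fun ω => x ω p) (hZ : ∀ p a, Measurable fun ω => Z ω p a)
    (hW : ∀ j i i', Measurable fun ω => W ω j i i') (a : Fin q) :
    Measurable fun ω => regressionCoef (x ω) (Z ω) (W ω) a := by
  have hb := measurable_blockWeight hW
  have hZT : ∀ a p, Measurable fun ω => (Z ω)ᵀ a p := fun a p => hZ p a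
  exact measurable_matrix_mulVec
    (measurable_matrix_inv (measurable_matrix_mul (measurable_matrix_mul hZT hb) hZ))
    (measurable_matrix_mulVec hZT (measurable_matrix_mulVec hb hx)) a

end Measurability

/-! ### Conditionally centred linear combinations -/

/-- A variable linear in `D`-measurable coefficients and in conditionally centred errors is
conditionally centred. The coefficients need not be integrable, nor need the single terms. -/
theorem condExp_sum_mul_eq_zero {Ω ι : Type*} [Fintype ι] {D m0 : MeasurableSpace Ω}
    {μ : Measure Ω} [IsProbabilityMeasure μ] (hD : D ≤ m0) {c e : ι → Ω → ℝ}
    (hc : ∀ i, Measurable[D] (c i)) (he : ∀ i, Integrable (e i) μ)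
    (he0 : ∀ i, μ[e i | D] =ᵐ[μ] 0) (hf : Integrable (fun ω => ∑ i, c i ω * e i ω) μ) :
    μ[fun ω => ∑ i, c i ω * e i ω | D] =ᵐ[μ] 0 := by
  set f : Ω → ℝ := fun ω => ∑ i, c i ω * e i ω with hfdef
  -- localize to the events on which all coefficients are bounded
  set A : ℕ → Set Ω := fun M => ⋂ i, {ω | |c i ω| ≤ M} with hA
  have hAm : ∀ M, MeasurableSet[D] (A M) := fun M => MeasurableSet.iInter (m := D) fun i =>
    measurableSet_le (α := ℝ) (measurable_abs.comp (hc i)) measurable_const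
  have hzero : ∀ M, (A M).indicator (μ[f | D]) =ᵐ[μ] 0 := by
    intro M
    have hcm : ∀ i, StronglyMeasurable[D] ((A M).indicator (c i)) := fun i =>
      (hc i).stronglyMeasurable.indicator (hAm M)
    have hcb : ∀ i ω, ‖(A M).indicator (c i) ω‖ ≤ M := by
      intro i ω
      by_cases h : ω ∈ A M
      · rw [Set.indicator_of_mem h]
        exact Set.mem_iInter.1 h i
      · rw [Set.indicator_of_notMem h]
        simp
    have hti : ∀ i, Integrable ((A M).indicator (c i) * e i) μ := fun i =>
      (he i).bdd_mul ((hcm i).mono hD).aestronglyMeasurable (ae_of_all _ (hcb i))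
    have hind : (A M).indicator f = ∑ i, (A M).indicator (c i) * e i := by
      ext ω
      by_cases h : ω ∈ A M <;> simp [h, hfdef]
    have h1 := condExp_indicator (m := D) hf (hAm M)
    have h2 := condExp_finsetSum (μ := μ) (s := Finset.univ) (fun i _ => hti i) D
    have h3 : ∀ᵐ ω ∂μ, ∀ i, (μ[(A M).indicator (c i) * e i | D]) ω = 0 := ae_all_iff.2 fun i => by
      filter_upwards [condExp_mul_of_stronglyMeasurable_left (hcm i) (hti i) (he i), he0 i]
        with ω h h'
      rw [h, Pi.mul_apply, h']
      simp
    rw [hind] at h1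
    filter_upwards [h1, h2, h3] with ω e1 e2 e3
    rw [← e1, e2, Finset.sum_apply]
    simp [e3]
  filter_upwards [ae_all_iff.2 hzero] with ω h
  obtain ⟨M, hM⟩ := exists_nat_ge (∑ i, |c i ω|)
  have : ω ∈ A M := Set.mem_iInter.2 fun i =>
    (Finset.single_le_sum (f := fun i => |c i ω|) (fun i _ => abs_nonneg _)
      (Finset.mem_univ i)).trans hM
  have h' := h M
  rwa [Set.indicator_of_mem this] at h'

namespace ClusterExperiment

variable {L : Type v} {q : L → ℕ} {B : ℕ} (E : ClusterExperiment.{u, v} L q B)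

/-! ### The σ-algebras of a cluster -/

/-- The σ-algebra generated by all data of cluster `j`. -/
@[reducible] def dataSigma (j : Fin E.N) : MeasurableSpace E.Ω :=
  MeasurableSpace.comap (fun ω => (E.covariates j ω, E.responses j ω)) inferInstance

/-- The σ-algebra generated by one sign. -/
@[reducible] def signSigma (p : Fin B × Fin E.N) : MeasurableSpace E.Ω :=
  MeasurableSpace.comap (fun ω => E.sign ω p.1 p.2) inferInstance

/-- The σ-algebras of the data of single clusters and those of single signs, as one family. -/
@[reducible] def unitSigma : Fin E.N ⊕ (Fin B × Fin E.N) → MeasurableSpace E.Ω :=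
  Sum.elim E.dataSigma E.signSigma

/-- The members of `unitSigma` that belong to cluster `k`. -/
def clusterUnits (k : Fin E.N) : Set (Fin E.N ⊕ (Fin B × Fin E.N)) :=
  {i | Sum.elim id Prod.snd i = k}

/-- The σ-algebra generated by the data and the signs of cluster `k`. -/
@[reducible] def ownSigma (k : Fin E.N) : MeasurableSpace E.Ω :=
  ⨆ i ∈ E.clusterUnits k, E.unitSigma i

/-- The σ-algebra generated by the data and the signs of all clusters but `k`. -/
@[reducible] def otherSigma (k : Fin E.N) : MeasurableSpace E.Ω :=
  ⨆ i ∈ (E.clusterUnits k)ᶜ, E.unitSigma i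

/-- The σ-algebra generated by the covariates of all clusters but `k`. -/
@[reducible] def otherDesignSigma (k : Fin E.N) : MeasurableSpace E.Ω :=
  ⨆ j ∈ ({k}ᶜ : Set (Fin E.N)), E.clusterSigma j

theorem clusterSigma_le_dataSigma (j : Fin E.N) : E.clusterSigma j ≤ E.dataSigma j :=
  Measurable.comap_le (measurable_fst.comp
    (comap_measurable fun ω => (E.covariates j ω, E.responses j ω)))

theorem clusterSigma_sup_otherDesignSigma (k : Fin E.N) :
    E.clusterSigma k ⊔ E.otherDesignSigma k = E.designSigma := by
  refine le_antisymm (sup_le (le_iSup _ k) (iSup₂_le fun j _ => le_iSup _ j)) (iSup_le fun j => ?_)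
  by_cases h : j = k
  · subst h
    exact le_sup_left
  · exact (le_iSup₂ (f := fun j (_ : j ∈ ({k}ᶜ : Set (Fin E.N))) => E.clusterSigma j) j h).trans
      le_sup_right

theorem dataSigma_le_ownSigma (k : Fin E.N) : E.dataSigma k ≤ E.ownSigma k :=
  le_iSup₂ (f := fun i (_ : i ∈ E.clusterUnits k) => E.unitSigma i) (Sum.inl k) rfl

theorem signSigma_le_ownSigma (b : Fin B) (k : Fin E.N) : E.signSigma (b, k) ≤ E.ownSigma k :=
  le_iSup₂ (f := fun i (_ : i ∈ E.clusterUnits k) => E.unitSigma i) (Sum.inr (b, k)) rfl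

theorem ownSigma_le_otherSigma {j k : Fin E.N} (h : j ≠ k) : E.ownSigma j ≤ E.otherSigma k :=
  iSup₂_le fun i hi => le_iSup₂ (f := fun i (_ : i ∈ (E.clusterUnits k)ᶜ) => E.unitSigma i) i
    fun hk => h ((show _ = j from hi).symm.trans (show _ = k from hk))

theorem clusterSigma_le_ownSigma (k : Fin E.N) : E.clusterSigma k ≤ E.ownSigma k :=
  (E.clusterSigma_le_dataSigma k).trans (E.dataSigma_le_ownSigma k)

theorem otherDesignSigma_le_otherSigma (k : Fin E.N) : E.otherDesignSigma k ≤ E.otherSigma k :=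
  iSup₂_le fun j hj => (E.clusterSigma_le_ownSigma j).trans (E.ownSigma_le_otherSigma hj)

namespace Standing

variable {E} (h : E.Standing)
include h

theorem dataSigma_le (j : Fin E.N) : E.dataSigma j ≤ E.mΩ :=
  ((h.measurable_covariates j).prodMk (h.measurable_responses j)).comap_le

theorem signSigma_le (p : Fin B × Fin E.N) : E.signSigma p ≤ E.mΩ :=
  (h.measurable_sign p.1 p.2).comap_le

theorem unitSigma_le (i : Fin E.N ⊕ (Fin B × Fin E.N)) : E.unitSigma i ≤ E.mΩ := by
  rcases i with j | p
  · exact h.dataSigma_le j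
  · exact h.signSigma_le p

theorem ownSigma_le (k : Fin E.N) : E.ownSigma k ≤ E.mΩ := iSup₂_le fun i _ => h.unitSigma_le i

theorem otherSigma_le (k : Fin E.N) : E.otherSigma k ≤ E.mΩ := iSup₂_le fun i _ => h.unitSigma_le i

theorem designSigma_le : E.designSigma ≤ E.mΩ := iSup_le fun j => (h.measurable_covariates j).comap_le

theorem iIndep_unitSigma : iIndep E.unitSigma E.P := by
  refine iIndep_sumElim h.indep_clusters h.indep_sign ?_
  refine (indep_of_indep_of_le_left (indep_of_indep_of_le_right h.indep_sign_data
    (iSup_le fun j => ?_)) (iSup_le fun p => ?_)).symm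
  · exact ((measurable_pi_apply j).comp (comap_measurable
      fun ω j => (E.covariates j ω, E.responses j ω))).comap_le
  · exact ((measurable_pi_apply p.2).comp ((measurable_pi_apply p.1).comp
      (comap_measurable E.sign))).comap_le

theorem indep_ownSigma_otherSigma (k : Fin E.N) : Indep (E.ownSigma k) (E.otherSigma k) E.P :=
  indep_iSup_of_disjoint h.unitSigma_le h.iIndep_unitSigma disjoint_compl_right

/-- Given all covariates, the data and the signs of the other clusters do not help to predict a
function of the data and the signs of cluster `k`. -/
theorem condExp_design_sup_otherSigma {F : Type*} [NormedAddCommGroup F] [NormedSpace ℝ F]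
    [CompleteSpace F] (k : Fin E.N) {f : E.Ω → F} (hf : Integrable f E.P)
    (hfm : StronglyMeasurable[E.designSigma ⊔ E.ownSigma k] f) :
    E.P[f | E.designSigma ⊔ E.otherSigma k] =ᵐ[E.P] E.P[f | E.designSigma] := by
  have hd := E.clusterSigma_sup_otherDesignSigma k
  have e1 : E.designSigma ⊔ E.otherSigma k = E.clusterSigma k ⊔ E.otherSigma k := by
    rw [← hd, sup_assoc, sup_eq_right.2 (E.otherDesignSigma_le_otherSigma k)]
  have e2 : E.designSigma ⊔ E.ownSigma k = E.otherDesignSigma k ⊔ E.ownSigma k := by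
    rw [← hd, sup_comm (E.clusterSigma k), sup_assoc,
      sup_eq_right.2 (E.clusterSigma_le_ownSigma k)]
  rw [e1, ← hd]
  rw [e2] at hfm
  exact condExp_sup_eq_condExp_sup (E.clusterSigma_le_ownSigma k)
    (E.otherDesignSigma_le_otherSigma k) (h.ownSigma_le k) (h.otherSigma_le k)
    (h.indep_ownSigma_otherSigma k) hf hfm

/-- The covariates of the other clusters do not help to predict the data of cluster `k` from its
own covariates. -/
theorem condExp_design_eq_condExp_cluster (k : Fin E.N) {f : E.Ω → ℝ} (hf : Integrable f E.P)
    (hfm : StronglyMeasurable[E.ownSigma k] f) :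
    E.P[f | E.designSigma] =ᵐ[E.P] E.P[f | E.clusterSigma k] := by
  rw [← E.clusterSigma_sup_otherDesignSigma k]
  exact condExp_sup_of_indep (E.clusterSigma_le_ownSigma k) (h.ownSigma_le k)
    ((E.otherDesignSigma_le_otherSigma k).trans (h.otherSigma_le k))
    (indep_of_indep_of_le_right (h.indep_ownSigma_otherSigma k)
      (E.otherDesignSigma_le_otherSigma k)) hf hfm

end Standing

/-! ### Measurability of the scores -/

theorem measurable_x (l : L) (j : Fin E.N) (i : Fin (E.size j)) :
    Measurable[E.clusterSigma j] fun ω => E.x ω l j i :=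
  (measurable_pi_apply i).comp ((measurable_pi_apply l).comp
    (measurable_fst.comp (comap_measurable (E.covariates j))))

theorem measurable_Z (l : L) (j : Fin E.N) (i : Fin (E.size j)) (a : Fin (q l)) :
    Measurable[E.clusterSigma j] fun ω => E.Z ω l j i a :=
  (measurable_pi_apply a).comp ((measurable_pi_apply i).comp ((measurable_pi_apply l).comp
    (measurable_snd.comp (comap_measurable (E.covariates j)))))

theorem measurable_y (l : L) (j : Fin E.N) (i : Fin (E.size j)) :
    Measurable[E.dataSigma j] fun ω => E.y ω l j i :=
  (measurable_pi_apply i).comp ((measurable_pi_apply l).comp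
    (measurable_snd.comp (comap_measurable fun ω => (E.covariates j ω, E.responses j ω))))

/-- The coefficient of the `i`-th model error of cluster `j` in the cluster score. -/
def errorCoef (l : L) (j : Fin E.N) (i : Fin (E.size j)) (ω : E.Ω) : ℝ :=
  ∑ i', (E.xStack l ω - E.ZStack l ω *ᵥ
    regressionCoef (E.xStack l ω) (E.ZStack l ω) (E.W ω l)) ⟨j, i'⟩ * E.W ω l j i' i

/-- The model error `y - x β₀ - Z γ` of one observation. -/
def modelError (β₀ : L → ℝ) (l : L) (γ : Fin (q l) → ℝ) (j : Fin E.N) (i : Fin (E.size j))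
    (ω : E.Ω) : ℝ :=
  E.y ω l j i - (E.x ω l j i * β₀ l + ∑ a, E.Z ω l j i a * γ a)

theorem measurable_modelError (β₀ : L → ℝ) (l : L) (γ : Fin (q l) → ℝ) (j : Fin E.N)
    (i : Fin (E.size j)) : Measurable[E.dataSigma j] (E.modelError β₀ l γ j i) := by
  have hc := E.clusterSigma_le_dataSigma j
  exact (E.measurable_y l j i).sub
    ((((E.measurable_x l j i).mono hc le_rfl).mul_const _).add
      (Finset.measurable_fun_sum _ fun a _ =>
        ((E.measurable_Z l j i a).mono hc le_rfl).mul_const _))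

namespace Standing

variable {E} (h : E.Standing)
include h

theorem zeta_eq (β₀ : L → ℝ) (l : L) (γ : Fin (q l) → ℝ) (j : Fin E.N) (ω : E.Ω) :
    E.zeta β₀ l γ j ω = ∑ i, E.errorCoef l j i ω * E.modelError β₀ l γ j i ω := by
  rw [zeta, clusterScore_eq _ _ (h.weight_posDef ω l), Finset.sum_comm]
  refine Finset.sum_congr rfl fun i _ => ?_
  rw [errorCoef, ← Finset.sum_mul]
  congr 1
  simp [modelError, yStack, xStack, ZStack, Matrix.mulVec, dotProduct, mul_comm]

theorem measurable_errorCoef (l : L) (j : Fin E.N) (i : Fin (E.size j)) :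
    Measurable[E.designSigma] (E.errorCoef l j i) := by
  have hc : ∀ j, E.clusterSigma j ≤ E.designSigma := fun j => le_iSup _ j
  let _ : MeasurableSpace E.Ω := E.designSigma
  have hx : ∀ p, Measurable fun ω => E.xStack l ω p := fun p =>
    (E.measurable_x l p.1 p.2).mono (hc _) le_rfl
  have hZ : ∀ p a, Measurable fun ω => E.ZStack l ω p a := fun p a =>
    (E.measurable_Z l p.1 p.2 a).mono (hc _) le_rfl
  have hW : ∀ j i i', Measurable fun ω => E.W ω l j i i' := h.measurable_weight l
  have hδ := measurable_regressionCoef hx hZ hW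
  exact Finset.measurable_fun_sum _ fun i' _ =>
    ((hx _).sub (measurable_matrix_mulVec hZ hδ _)).mul (hW _ _ _)

theorem measurable_zeta_design_sup (β₀ : L → ℝ) (l : L) (γ : Fin (q l) → ℝ) (j : Fin E.N) :
    Measurable[E.designSigma ⊔ E.dataSigma j] (E.zeta β₀ l γ j) := by
  rw [funext fun ω => h.zeta_eq β₀ l γ j ω]
  exact Finset.measurable_fun_sum _ fun i _ =>
    ((h.measurable_errorCoef l j i).mono le_sup_left le_rfl).mul
      ((E.measurable_modelError β₀ l γ j i).mono le_sup_right le_rfl)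

theorem measurable_zeta (β₀ : L → ℝ) (l : L) (γ : Fin (q l) → ℝ) (j : Fin E.N) :
    Measurable (E.zeta β₀ l γ j) :=
  (h.measurable_zeta_design_sup β₀ l γ j).mono (sup_le h.designSigma_le (h.dataSigma_le j)) le_rfl

theorem measurable_gammaHat (β₀ : L → ℝ) (l : L) (a : Fin (q l)) :
    Measurable fun ω => E.gammaHat β₀ l ω a := by
  have hc : ∀ j, E.clusterSigma j ≤ E.mΩ := fun j => (le_iSup _ j).trans h.designSigma_le
  have hx : ∀ p, Measurable fun ω => E.xStack l ω p := fun p =>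
    (E.measurable_x l p.1 p.2).mono (hc _) le_rfl
  have hZ : ∀ p a, Measurable fun ω => E.ZStack l ω p a := fun p a =>
    (E.measurable_Z l p.1 p.2 a).mono (hc _) le_rfl
  have hW : ∀ j i i', Measurable fun ω => E.W ω l j i i' := fun j i i' =>
    (h.measurable_weight l j i i').mono h.designSigma_le le_rfl
  have hy : ∀ p, Measurable fun ω => E.yStack l ω p := fun p =>
    (E.measurable_y l p.1 p.2).mono (h.dataSigma_le _) le_rfl
  -- `γ̂` is the regression coefficient of `y - β₀ x`
  exact measurable_regressionCoef (x := fun ω => E.yStack l ω - β₀ l • E.xStack l ω)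
    (fun p => (hy p).sub ((hx p).const_mul _)) hZ hW a

theorem measurable_zeta_gammaHat (β₀ : L → ℝ) (l : L) (j : Fin E.N) :
    Measurable fun ω => E.zeta β₀ l (E.gammaHat β₀ l ω) j ω := by
  have hc : ∀ j, E.clusterSigma j ≤ E.mΩ := fun j => (le_iSup _ j).trans h.designSigma_le
  simp only [fun ω => h.zeta_eq β₀ l (E.gammaHat β₀ l ω) j ω]
  refine Finset.measurable_fun_sum _ fun i _ =>
    ((h.measurable_errorCoef l j i).mono h.designSigma_le le_rfl).mul ?_
  exact ((E.measurable_y l j i).mono (h.dataSigma_le j) le_rfl).sub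
    ((((E.measurable_x l j i).mono (hc j) le_rfl).mul_const _).add
      (Finset.measurable_fun_sum _ fun a _ =>
        ((E.measurable_Z l j i a).mono (hc j) le_rfl).mul (h.measurable_gammaHat β₀ l a)))

theorem measurable_flippedScore (β₀ : L → ℝ) (b : Fin B) (l : L) :
    Measurable (E.flippedScore β₀ b l) :=
  (Finset.measurable_fun_sum _ fun j _ =>
    (h.measurable_sign b j).mul (h.measurable_zeta_gammaHat β₀ l j)).const_mul _

/-- Under the mean model, integrable cluster scores at the true nuisance value are centred
conditionally on the covariates. -/
theorem condExp_zeta_eq_zero (β₀ : L → ℝ) (l : L) (γ : Fin (q l) → ℝ) (j : Fin E.N)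
    (hmean : ∀ i, Integrable (fun ω => E.y ω l j i) E.P ∧
      E.P[fun ω => E.y ω l j i | E.clusterSigma j] =ᵐ[E.P]
        fun ω => E.x ω l j i * β₀ l + ∑ a, E.Z ω l j i a * γ a)
    (hint : Integrable (E.zeta β₀ l γ j) E.P) :
    E.P[E.zeta β₀ l γ j | E.designSigma] =ᵐ[E.P] 0 := by
  have hce : ∀ i, Integrable (fun ω => E.x ω l j i * β₀ l + ∑ a, E.Z ω l j i a * γ a) E.P :=
    fun i => (integrable_congr (hmean i).2).1 integrable_condExp
  have hcm : ∀ i, StronglyMeasurable[E.clusterSigma j]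
      (fun ω => E.x ω l j i * β₀ l + ∑ a, E.Z ω l j i a * γ a) := fun i =>
    (((E.measurable_x l j i).mul_const _).add (Finset.measurable_fun_sum _ fun a _ =>
      (E.measurable_Z l j i a).mul_const _)).stronglyMeasurable
  have hce0 : ∀ i, E.P[E.modelError β₀ l γ j i | E.designSigma] =ᵐ[E.P] 0 := by
    intro i
    have h1 := h.condExp_design_eq_condExp_cluster j (f := E.modelError β₀ l γ j i)
      ((hmean i).1.sub (hce i))
      ((E.measurable_modelError β₀ l γ j i).mono (E.dataSigma_le_ownSigma j)
        le_rfl).stronglyMeasurable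
    filter_upwards [h1, condExp_sub (hmean i).1 (hce i) (E.clusterSigma j), (hmean i).2]
      with ω a1 a2 a3
    rw [a1]
    refine a2.trans ?_
    rw [Pi.sub_apply, a3, condExp_of_stronglyMeasurable (h.measurable_covariates j).comap_le (hcm i)
      (hce i)]
    simp
  rw [funext fun ω => h.zeta_eq β₀ l γ j ω] at hint ⊢
  exact condExp_sum_mul_eq_zero h.designSigma_le (h.measurable_errorCoef l j)
    (fun i => (hmean i).1.sub (hce i)) hce0 hint

end Standing

end ClusterExperiment

namespace ClusterExperiment

variable {L : Type v} {q : L → ℕ} {B : ℕ} {E : ClusterExperiment.{u, v} L q B}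

/-! ### Linear combinations of the scores and their conditional moments -/

theorem measurable_sign_comap (E : ClusterExperiment.{u, v} L q B) (b : Fin B) (j : Fin E.N) :
    Measurable[MeasurableSpace.comap E.sign inferInstance] fun ω => E.sign ω b j :=
  (measurable_pi_apply j).comp ((measurable_pi_apply b).comp (comap_measurable E.sign))

section Combo

variable [Fintype L]

/-- A fixed linear combination over outcomes of the scores of cluster `j`. -/
def comboScore (E : ClusterExperiment.{u, v} L q B)
    (β₀ : L → ℝ) (γ : ∀ l, Fin (q l) → ℝ) (t : L → ℝ) (j : Fin E.N) (ω : E.Ω) : ℝ :=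
  ∑ l, t l * E.zeta β₀ l (γ l) j ω

/-- A fixed linear combination, over transformations and outcomes, of the sign-flipped scores of
cluster `j`. -/
def flippedCombo (E : ClusterExperiment.{u, v} L q B)
    (β₀ : L → ℝ) (γ : ∀ l, Fin (q l) → ℝ) (t : Fin B → L → ℝ) (j : Fin E.N) (ω : E.Ω) : ℝ :=
  ∑ b, E.sign ω b j * E.comboScore β₀ γ (t b) j ω

variable {β₀ : L → ℝ} {γ : ∀ l, Fin (q l) → ℝ}

theorem memLp_comboScore (j : Fin E.N) (hL2 : ∀ l, MemLp (E.zeta β₀ l (γ l) j) 2 E.P)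
    (t : L → ℝ) : MemLp (E.comboScore β₀ γ t j) 2 E.P :=
  memLp_finsetSum _ fun l _ => (hL2 l).const_mul (t l)

theorem condExp_comboScore_eq_zero (j : Fin E.N)
    (hL2 : ∀ l, MemLp (E.zeta β₀ l (γ l) j) 2 E.P)
    (h0 : ∀ l, E.P[E.zeta β₀ l (γ l) j | E.designSigma] =ᵐ[E.P] 0) (t : L → ℝ) :
    E.P[E.comboScore β₀ γ t j | E.designSigma] =ᵐ[E.P] 0 := by
  have hfun : E.comboScore β₀ γ t j = ∑ l, t l • E.zeta β₀ l (γ l) j := by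
    ext ω
    simp [comboScore]
  rw [hfun]
  have h1 := condExp_finsetSum (μ := E.P) (s := Finset.univ)
    (fun l _ => ((hL2 l).integrable one_le_two).smul (t l)) E.designSigma
  filter_upwards [h1, ae_all_iff.2 fun l => condExp_smul (μ := E.P) (t l) (E.zeta β₀ l (γ l) j)
    E.designSigma, ae_all_iff.2 h0] with ω a1 a2 a3
  rw [a1, Finset.sum_apply]
  exact Finset.sum_eq_zero fun l _ => by rw [a2 l, Pi.smul_apply, a3 l]; simp

/-- As the scores are conditionally centred, their conditional covariances are the conditional
expectations of their products. -/
theorem condExp_comboScore_sq (j : Fin E.N)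
    (hL2 : ∀ l, MemLp (E.zeta β₀ l (γ l) j) 2 E.P)
    (h0 : ∀ l, E.P[E.zeta β₀ l (γ l) j | E.designSigma] =ᵐ[E.P] 0) (t : L → ℝ) :
    E.P[fun ω => E.comboScore β₀ γ t j ω ^ 2 | E.designSigma] =ᵐ[E.P]
      fun ω => ∑ l, ∑ l', t l * t l' *
        E.designCov (E.zeta β₀ l (γ l) j) (E.zeta β₀ l' (γ l') j) ω := by
  have hfun : (fun ω => E.comboScore β₀ γ t j ω ^ 2) =
      ∑ p : L × L, (t p.1 * t p.2) • (E.zeta β₀ p.1 (γ p.1) j * E.zeta β₀ p.2 (γ p.2) j) := by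
    ext ω
    rw [sq, comboScore, Finset.sum_mul_sum, Finset.sum_apply, Fintype.sum_prod_type]
    refine Finset.sum_congr rfl fun l _ => Finset.sum_congr rfl fun l' _ => ?_
    simp only [Pi.smul_apply, Pi.mul_apply, smul_eq_mul]
    ring
  have hint : ∀ p : L × L, Integrable (E.zeta β₀ p.1 (γ p.1) j * E.zeta β₀ p.2 (γ p.2) j) E.P :=
    fun p => (hL2 p.1).integrable_mul (hL2 p.2)
  have hcov : ∀ p : L × L, E.designCov (E.zeta β₀ p.1 (γ p.1) j) (E.zeta β₀ p.2 (γ p.2) j) =ᵐ[E.P]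
      E.P[E.zeta β₀ p.1 (γ p.1) j * E.zeta β₀ p.2 (γ p.2) j | E.designSigma] := by
    intro p
    refine condExp_congr_ae ?_
    filter_upwards [h0 p.1, h0 p.2] with ω a1 a2
    simp [a1, a2]
  rw [hfun]
  have h1 := condExp_finsetSum (μ := E.P) (s := Finset.univ)
    (fun p _ => (hint p).smul (t p.1 * t p.2)) E.designSigma
  filter_upwards [h1, ae_all_iff.2 fun p : L × L => condExp_smul (μ := E.P) (t p.1 * t p.2)
    (E.zeta β₀ p.1 (γ p.1) j * E.zeta β₀ p.2 (γ p.2) j) E.designSigma, ae_all_iff.2 hcov]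
    with ω a1 a2 a3
  rw [a1, Finset.sum_apply, Fintype.sum_prod_type]
  refine Finset.sum_congr rfl fun l _ => Finset.sum_congr rfl fun l' _ => ?_
  rw [a2 (l, l'), Pi.smul_apply, ← a3 (l, l'), smul_eq_mul]

end Combo

/-! ### Moments of the signs and of the sign-flipped scores -/

namespace Standing

section Signs

variable (h : E.Standing)
include h

theorem ae_sign_eq (b : Fin B) (j : Fin E.N) :
    ∀ᵐ ω ∂E.P, E.sign ω b j = 1 ∨ E.sign ω b j = -1 := by
  by_cases hb : b.val = 0
  · exact ae_of_all _ fun ω => Or.inl (h.sign_first ω b j hb)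
  · have hm := h.measurable_sign b j
    have h1 : MeasurableSet {ω | E.sign ω b j = 1} := hm (measurableSet_singleton 1)
    have h2 : MeasurableSet {ω | E.sign ω b j = -1} := hm (measurableSet_singleton (-1))
    have hd : Disjoint {ω | E.sign ω b j = 1} {ω | E.sign ω b j = -1} :=
      Set.disjoint_left.2 fun ω (a : E.sign ω b j = 1) (a' : E.sign ω b j = -1) => by
        rw [a] at a'
        norm_num at a'
    have hu : E.P ({ω | E.sign ω b j = 1} ∪ {ω | E.sign ω b j = -1}) = 1 := by
      rw [measure_union hd h2, (h.sign_uniform b j hb).1, (h.sign_uniform b j hb).2,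
        ENNReal.add_halves]
    exact (prob_compl_eq_zero_iff (h1.union h2)).2 hu

theorem ae_abs_sign (b : Fin B) (j : Fin E.N) : ∀ᵐ ω ∂E.P, |E.sign ω b j| = 1 := by
  filter_upwards [h.ae_sign_eq b j] with ω hω
  rcases hω with hω | hω <;> simp [hω]

theorem integral_sign_eq_zero (b : Fin B) (hb : b.val ≠ 0) (j : Fin E.N) :
    ∫ ω, E.sign ω b j ∂E.P = 0 := by
  have hm := h.measurable_sign b j
  have h1 : MeasurableSet {ω | E.sign ω b j = 1} := hm (measurableSet_singleton 1)
  have h2 : MeasurableSet {ω | E.sign ω b j = -1} := hm (measurableSet_singleton (-1))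
  have e : (fun ω => E.sign ω b j) =ᵐ[E.P] fun ω =>
      {ω | E.sign ω b j = 1}.indicator (fun _ => (1 : ℝ)) ω -
        {ω | E.sign ω b j = -1}.indicator (fun _ => (1 : ℝ)) ω := by
    filter_upwards [h.ae_sign_eq b j] with ω hω
    rcases hω with hω | hω <;> simp [Set.indicator, hω] <;> norm_num
  rw [integral_congr_ae e, integral_sub ((integrable_const _).indicator h1)
    ((integrable_const _).indicator h2), integral_indicator h1, integral_indicator h2]
  simp [measureReal_def, (h.sign_uniform b j hb).1, (h.sign_uniform b j hb).2]

/-- Different rows of signs are uncorrelated. The first row is constant, but at most one of two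
different rows is the first. -/
theorem integral_sign_mul_sign (b b' : Fin B) (j : Fin E.N) :
    ∫ ω, E.sign ω b j * E.sign ω b' j ∂E.P = if b = b' then 1 else 0 := by
  split_ifs with hb
  · subst hb
    rw [integral_congr_ae (g := fun _ => (1 : ℝ))]
    · simp
    · filter_upwards [h.ae_abs_sign b j] with ω hω
      rw [← abs_mul_abs_self, hω, one_mul]
  · have hind : IndepFun (fun ω => E.sign ω b j) (fun ω => E.sign ω b' j) E.P :=
      h.indep_sign.indepFun (i := (b, j)) (j := (b', j)) (by simp [hb])
    rw [hind.integral_fun_mul_eq_mul_integral (h.measurable_sign b j).aestronglyMeasurable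
      (h.measurable_sign b' j).aestronglyMeasurable]
    by_cases hb0 : b.val = 0
    · rw [h.integral_sign_eq_zero b' (fun h' => hb (Fin.ext (hb0.trans h'.symm))) j, mul_zero]
    · rw [h.integral_sign_eq_zero b hb0 j, zero_mul]

/-- A function of the signs and a function of the data are independent; the former enters a
conditional expectation given the covariates through its mean. -/
theorem condExp_sign_mul {s g : E.Ω → ℝ}
    (hsm : Measurable[MeasurableSpace.comap E.sign inferInstance] s)
    (hsb : ∀ᵐ ω ∂E.P, |s ω| ≤ 1) (hgm : Measurable[⨆ j, E.dataSigma j] g) (hg : Integrable g E.P) :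
    E.P[fun ω => s ω * g ω | E.designSigma] =ᵐ[E.P]
      fun ω => (∫ ω, s ω ∂E.P) * (E.P[g | E.designSigma]) ω := by
  have hs0 : MeasurableSpace.comap E.sign inferInstance ≤ E.mΩ :=
    (measurable_pi_lambda _ fun b => measurable_pi_lambda _ fun j =>
      h.measurable_sign b j).comap_le
  have hs : Integrable s E.P := Integrable.of_bound (hsm.mono hs0 le_rfl).aestronglyMeasurable 1 hsb
  have hind : Indep (MeasurableSpace.comap E.sign inferInstance) (⨆ j, E.dataSigma j) E.P :=
    indep_of_indep_of_le_right h.indep_sign_data (iSup_le fun j =>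
      ((measurable_pi_apply j).comp (comap_measurable
        fun ω j => (E.covariates j ω, E.responses j ω))).comap_le)
  exact condExp_mul_of_indep
    (iSup_le fun j => (E.clusterSigma_le_dataSigma j).trans (le_iSup _ j)) hs0
    (iSup_le h.dataSigma_le) hind hs hsm.stronglyMeasurable hgm.stronglyMeasurable
    (hg.bdd_mul (hsm.mono hs0 le_rfl).aestronglyMeasurable hsb)

end Signs

section Flipped

variable [Fintype L]

variable {β₀ : L → ℝ} {γ : ∀ l, Fin (q l) → ℝ} (h : E.Standing)
include h

theorem measurable_comboScore_design_sup (t : L → ℝ) (j : Fin E.N) :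
    Measurable[E.designSigma ⊔ E.dataSigma j] (E.comboScore β₀ γ t j) :=
  Finset.measurable_fun_sum _ fun l _ => (h.measurable_zeta_design_sup β₀ l (γ l) j).const_mul _

theorem measurable_flippedCombo_design_sup (t : Fin B → L → ℝ) (j : Fin E.N) :
    Measurable[E.designSigma ⊔ E.ownSigma j] (E.flippedCombo β₀ γ t j) :=
  Finset.measurable_fun_sum _ fun b _ =>
    ((comap_measurable fun ω => E.sign ω b j).mono
      ((E.signSigma_le_ownSigma b j).trans le_sup_right) le_rfl).mul
      ((h.measurable_comboScore_design_sup (t b) j).mono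
        (sup_le_sup_left (E.dataSigma_le_ownSigma j) _) le_rfl)

theorem measurable_flippedCombo (t : Fin B → L → ℝ) (j : Fin E.N) :
    Measurable (E.flippedCombo β₀ γ t j) :=
  (h.measurable_flippedCombo_design_sup t j).mono (sup_le h.designSigma_le (h.ownSigma_le j)) le_rfl

theorem memLp_flippedCombo (j : Fin E.N) (hL2 : ∀ l, MemLp (E.zeta β₀ l (γ l) j) 2 E.P)
    (t : Fin B → L → ℝ) : MemLp (E.flippedCombo β₀ γ t j) 2 E.P := by
  refine memLp_finsetSum _ fun b _ => ?_
  refine (memLp_comboScore j hL2 (t b)).of_le ?_ ?_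
  · exact (h.measurable_sign b j).aestronglyMeasurable.mul
      (memLp_comboScore j hL2 (t b)).aestronglyMeasurable
  · filter_upwards [h.ae_abs_sign b j] with ω hω
    rw [norm_mul, Real.norm_eq_abs (E.sign ω b j), hω, one_mul]

theorem measurable_comboScore_data (t : L → ℝ) (j : Fin E.N) :
    Measurable[⨆ j, E.dataSigma j] (E.comboScore β₀ γ t j) :=
  (h.measurable_comboScore_design_sup t j).mono (sup_le
    (iSup_le fun j => (E.clusterSigma_le_dataSigma j).trans (le_iSup _ j)) (le_iSup _ j)) le_rfl

theorem condExp_flippedCombo_eq_zero (j : Fin E.N)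
    (hL2 : ∀ l, MemLp (E.zeta β₀ l (γ l) j) 2 E.P)
    (h0 : ∀ l, E.P[E.zeta β₀ l (γ l) j | E.designSigma] =ᵐ[E.P] 0) (t : Fin B → L → ℝ) :
    E.P[E.flippedCombo β₀ γ t j | E.designSigma] =ᵐ[E.P] 0 := by
  have hfun : E.flippedCombo β₀ γ t j =
      ∑ b, fun ω => E.sign ω b j * E.comboScore β₀ γ (t b) j ω := by
    ext ω
    simp [flippedCombo]
  have hint : ∀ b, Integrable (E.comboScore β₀ γ (t b) j) E.P := fun b =>
    (memLp_comboScore j hL2 (t b)).integrable one_le_two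
  rw [hfun]
  have h1 := condExp_finsetSum (μ := E.P) (s := Finset.univ)
    (f := fun b ω => E.sign ω b j * E.comboScore β₀ γ (t b) j ω)
    (fun b _ => (hint b).bdd_mul (c := 1) (h.measurable_sign b j).aestronglyMeasurable
      ((h.ae_abs_sign b j).mono fun _ h => h.le)) E.designSigma
  filter_upwards [h1, ae_all_iff.2 fun b => h.condExp_sign_mul (measurable_sign_comap E b j)
    ((h.ae_abs_sign b j).mono fun _ h => h.le) (h.measurable_comboScore_data (t b) j) (hint b),
    ae_all_iff.2 fun b => condExp_comboScore_eq_zero j hL2 h0 (t b)] with ω a1 a2 a3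
  rw [a1, Finset.sum_apply]
  exact Finset.sum_eq_zero fun b _ => by rw [a2 b, a3 b]; simp

/-- Flipping by uncorrelated signs removes the conditional covariances between transformations. -/
theorem condExp_flippedCombo_sq (j : Fin E.N)
    (hL2 : ∀ l, MemLp (E.zeta β₀ l (γ l) j) 2 E.P)
    (h0 : ∀ l, E.P[E.zeta β₀ l (γ l) j | E.designSigma] =ᵐ[E.P] 0) (t : Fin B → L → ℝ) :
    E.P[fun ω => E.flippedCombo β₀ γ t j ω ^ 2 | E.designSigma] =ᵐ[E.P]
      fun ω => ∑ b, ∑ l, ∑ l', t b l * t b l' *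
        E.designCov (E.zeta β₀ l (γ l) j) (E.zeta β₀ l' (γ l') j) ω := by
  set F : Fin B × Fin B → E.Ω → ℝ := fun p ω => (E.sign ω p.1 j * E.sign ω p.2 j) *
    (E.comboScore β₀ γ (t p.1) j ω * E.comboScore β₀ γ (t p.2) j ω) with hF
  have hfun : (fun ω => E.flippedCombo β₀ γ t j ω ^ 2) = ∑ p, F p := by
    ext ω
    rw [sq, flippedCombo, Finset.sum_mul_sum, Finset.sum_apply, Fintype.sum_prod_type]
    refine Finset.sum_congr rfl fun b _ => Finset.sum_congr rfl fun b' _ => ?_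
    simp only [hF]
    ring
  have hint : ∀ p : Fin B × Fin B, Integrable
      (fun ω => E.comboScore β₀ γ (t p.1) j ω * E.comboScore β₀ γ (t p.2) j ω) E.P := fun p =>
    (memLp_comboScore j hL2 (t p.1)).integrable_mul (memLp_comboScore j hL2 (t p.2))
  have hsb : ∀ p : Fin B × Fin B, ∀ᵐ ω ∂E.P, |E.sign ω p.1 j * E.sign ω p.2 j| ≤ 1 := by
    intro p
    filter_upwards [h.ae_abs_sign p.1 j, h.ae_abs_sign p.2 j] with ω a1 a2
    rw [abs_mul, a1, a2, one_mul]
  have hFi : ∀ p, Integrable (F p) E.P := fun p =>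
    (hint p).bdd_mul ((h.measurable_sign p.1 j).mul
      (h.measurable_sign p.2 j)).aestronglyMeasurable (hsb p)
  rw [hfun]
  have h1 := condExp_finsetSum (μ := E.P) (s := Finset.univ) (fun p _ => hFi p) E.designSigma
  have h2 : ∀ p : Fin B × Fin B, E.P[F p | E.designSigma] =ᵐ[E.P] fun ω =>
      (if p.1 = p.2 then 1 else 0) * (E.P[fun ω => E.comboScore β₀ γ (t p.1) j ω *
        E.comboScore β₀ γ (t p.2) j ω | E.designSigma]) ω := by
    intro p
    rw [← h.integral_sign_mul_sign p.1 p.2 j]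
    exact h.condExp_sign_mul
      ((measurable_sign_comap E p.1 j).mul (measurable_sign_comap E p.2 j)) (hsb p)
      ((h.measurable_comboScore_data _ j).mul (h.measurable_comboScore_data _ j)) (hint p)
  filter_upwards [h1, ae_all_iff.2 h2,
    ae_all_iff.2 fun b => condExp_comboScore_sq j hL2 h0 (t b)] with ω a1 a2 a3
  rw [a1, Finset.sum_apply, Fintype.sum_prod_type]
  refine Finset.sum_congr rfl fun b _ => ?_
  rw [Finset.sum_eq_single b, a2 (b, b), ← a3 b]
  · simp [sq]
  · intro b' _ hb
    rw [a2 (b, b')]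
    simp [hb.symm]
  · simp

end Flipped

end Standing

end ClusterExperiment

/-! ### Convergence in probability -/

section InProb

variable {L : Type v} {q : L → ℕ} {B : ℕ} {E : ℕ → ClusterExperiment.{u, v} L q B}
  {X Y : ∀ k, (E k).Ω → ℝ} {c d : ℝ}

theorem tendstoInProb_const (c : ℝ) : TendstoInProb E (fun _ _ => c) c := by
  intro ε hε
  have : ∀ k, (E k).P {ω | ε < |c - c|} = 0 := fun k => by simp [not_lt.2 hε.le]
  simp only [this]
  exact tendsto_const_nhds

theorem TendstoInProb.add (hX : TendstoInProb E X c) (hY : TendstoInProb E Y d) :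
    TendstoInProb E (fun k ω => X k ω + Y k ω) (c + d) := by
  intro ε hε
  have h := (hX (ε / 2) (by linarith)).add (hY (ε / 2) (by linarith))
  rw [add_zero] at h
  refine tendsto_of_tendsto_of_tendsto_of_le_of_le tendsto_const_nhds h (fun _ => zero_le) fun k => ?_
  refine (measure_mono fun ω (hω : ε < _) => ?_).trans (measure_union_le _ _)
  by_contra hcon
  simp only [Set.mem_union, Set.mem_ofPred_eq, not_or, not_lt] at hcon
  have h3 := abs_add_le (X k ω - c) (Y k ω - d)
  rw [show X k ω - c + (Y k ω - d) = X k ω + Y k ω - (c + d) by ring] at h3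
  linarith [hcon.1, hcon.2]

theorem TendstoInProb.const_mul (hX : TendstoInProb E X c) (a : ℝ) :
    TendstoInProb E (fun k ω => a * X k ω) (a * c) := by
  intro ε hε
  refine tendsto_of_tendsto_of_tendsto_of_le_of_le tendsto_const_nhds
    (hX (ε / (|a| + 1)) (by positivity)) (fun _ => zero_le) fun k => ?_
  refine measure_mono fun ω (hω : ε < _) => ?_
  change ε / (|a| + 1) < |X k ω - c|
  rw [div_lt_iff₀ (by positivity)]
  rw [← mul_sub, abs_mul] at hω
  nlinarith [abs_nonneg (X k ω - c)]

theorem TendstoInProb.sum {ι : Type*} (s : Finset ι) {X : ι → ∀ k, (E k).Ω → ℝ} {c : ι → ℝ}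
    (h : ∀ i, TendstoInProb E (X i) (c i)) :
    TendstoInProb E (fun k ω => ∑ i ∈ s, X i k ω) (∑ i ∈ s, c i) := by
  classical
  induction s using Finset.induction_on with
  | empty => simpa using tendstoInProb_const (E := E) 0
  | insert i s his ih =>
    simp only [Finset.sum_insert his]
    exact (h i).add ih

theorem TendstoInProb.nonneg (hX : TendstoInProb E X c)
    (h0 : ∀ᶠ k in atTop, ∀ᵐ ω ∂(E k).P, 0 ≤ X k ω) : 0 ≤ c := by
  by_contra hc
  push Not at hc
  have h1 := hX (-c / 2) (by linarith)
  have h2 : ∀ᶠ k in atTop, (E k).P {ω | -c / 2 < |X k ω - c|} = 1 := by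
    filter_upwards [h0] with k hk
    rw [measure_eq_measure_of_null_sdiff (Set.subset_univ _), measure_univ]
    rw [← Set.compl_eq_univ_sdiff]
    refine measure_mono_null (fun ω hω => ?_) (ae_iff.1 hk)
    intro hpos
    apply hω
    change -c / 2 < |X k ω - c|
    rw [abs_of_nonneg (by linarith)]
    linarith
  exact zero_ne_one (tendsto_nhds_unique h1 (tendsto_const_nhds.congr' (h2.mono fun _ h => h.symm)))

theorem TendstoInProb.eventually_real_lt {X : ∀ k, (E k).Ω → ℝ} {c : ℝ} (hX : TendstoInProb E X c)
    {δ η : ℝ} (hδ : 0 < δ) (hη : 0 < η) :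
    ∀ᶠ k in atTop, (E k).P.real {ω | δ < |X k ω - c|} < η := by
  filter_upwards [(hX δ hδ).eventually_lt_const (ENNReal.ofReal_pos.2 hη)] with k hk
  exact ENNReal.toReal_lt_of_lt_ofReal hk

/-- The limiting covariance matrix, evaluated at a fixed vector of coefficients. -/
theorem CovarianceLimit.quadraticForm [Fintype L] {β₀ : L → ℝ} {γ : ∀ l, Fin (q l) → ℝ}
    {S : Matrix L L ℝ} (h4 : CovarianceLimit E β₀ γ S) (t : L → ℝ) :
    TendstoInProb E (fun k ω => ∑ l, ∑ l', t l * t l' * (((E k).total : ℝ)⁻¹ * ∑ j,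
      (E k).designCov ((E k).zeta β₀ l (γ l) j) ((E k).zeta β₀ l' (γ l') j) ω))
      (∑ l, ∑ l', t l * t l' * S l l') :=
  TendstoInProb.sum _ fun l => TendstoInProb.sum _ fun l' => (h4 l l').const_mul _

end InProb

namespace ClusterExperiment

variable {L : Type v} {q : L → ℕ} {B : ℕ} {E : ClusterExperiment.{u, v} L q B}

theorem abs_zeta_le [Fintype L] {β₀ : L → ℝ} {γ : ∀ l, Fin (q l) → ℝ}
    (j : Fin E.N) (l : L) (ω : E.Ω) :
    |E.zeta β₀ l (γ l) j ω| ≤ ‖E.zetaVec β₀ γ j ω‖ :=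
  PiLp.norm_apply_le (E.zetaVec β₀ γ j ω) l

namespace Standing

variable [Fintype L] (h : E.Standing) {β₀ : L → ℝ} {γ : ∀ l, Fin (q l) → ℝ}
include h

omit [Fintype L] in
theorem measurable_zetaVec (j : Fin E.N) : Measurable (E.zetaVec β₀ γ j) :=
  (WithLp.measurable_toLp 2 _).comp (measurable_pi_lambda _ fun l => h.measurable_zeta β₀ l (γ l) j)

/-- The sign-flipped linear combinations are dominated by the norm of the score vector. -/
theorem ae_abs_flippedCombo_le (t : Fin B → L → ℝ) (j : Fin E.N) :
    ∀ᵐ ω ∂E.P, |E.flippedCombo β₀ γ t j ω| ≤ (∑ b, ∑ l, |t b l|) * ‖E.zetaVec β₀ γ j ω‖ := by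
  filter_upwards [ae_all_iff.2 fun b => h.ae_abs_sign b j] with ω hω
  rw [flippedCombo, Finset.sum_mul]
  refine (Finset.abs_sum_le_sum_abs _ _).trans (Finset.sum_le_sum fun b _ => ?_)
  rw [abs_mul, hω b, one_mul, comboScore, Finset.sum_mul]
  refine (Finset.abs_sum_le_sum_abs _ _).trans (Finset.sum_le_sum fun l _ => ?_)
  rw [abs_mul]
  exact mul_le_mul_of_nonneg_left (abs_zeta_le j l ω) (abs_nonneg _)

/-- A finite truncated second moment implies square integrability. The truncation level is the one
of the Lindeberg condition with `ε = 1`. -/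
theorem memLp_zeta_of_lindeberg (hn : 0 < E.total)
    (hfin : ENNReal.ofReal ((E.total : ℝ)⁻¹) *
      ∑ j, ∫⁻ ω in {ω | 1 * √(E.total : ℝ) < ‖E.zetaVec β₀ γ j ω‖},
        ‖E.zetaVec β₀ γ j ω‖ₑ ^ 2 ∂E.P < ∞) (l : L) (j : Fin E.N) :
    MemLp (E.zeta β₀ l (γ l) j) 2 E.P := by
  have hn' : (0 : ℝ) < (E.total : ℝ)⁻¹ := by positivity
  have hsum : ∑ j, ∫⁻ ω in {ω | 1 * √(E.total : ℝ) < ‖E.zetaVec β₀ γ j ω‖},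
        ‖E.zetaVec β₀ γ j ω‖ₑ ^ 2 ∂E.P < ∞ :=
    ENNReal.lt_top_of_mul_ne_top_right hfin.ne (ENNReal.ofReal_pos.2 hn').ne'
  have hj := ENNReal.sum_lt_top.1 hsum j (Finset.mem_univ j)
  have hm := h.measurable_zetaVec (β₀ := β₀) (γ := γ) j
  set A := {ω | 1 * √(E.total : ℝ) < ‖E.zetaVec β₀ γ j ω‖} with hA
  have hAm : MeasurableSet A := measurableSet_lt measurable_const hm.norm
  have hvec : MemLp (E.zetaVec β₀ γ j) 2 E.P := by
    refine ⟨hm.aestronglyMeasurable, ?_⟩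
    rw [eLpNorm_lt_top_iff_lintegral_rpow_enorm_lt_top two_ne_zero ENNReal.ofNat_ne_top]
    simp only [ENNReal.toReal_ofNat, ENNReal.rpow_ofNat]
    rw [← lintegral_add_compl _ hAm]
    refine ENNReal.add_lt_top.2 ⟨hj, ?_⟩
    refine (setLIntegral_mono (measurable_const (a := ENNReal.ofReal (√(E.total : ℝ)) ^ 2))
      fun ω hω => ?_).trans_lt ?_
    · have : ‖E.zetaVec β₀ γ j ω‖ ≤ √(E.total : ℝ) := by simpa [hA] using hω
      rw [← ofReal_norm]
      gcongr
    · rw [setLIntegral_const]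
      exact ENNReal.mul_lt_top (by finiteness) (measure_lt_top _ _)
  exact hvec.of_le (h.measurable_zeta β₀ l (γ l) j).aestronglyMeasurable
    (ae_of_all _ fun ω => abs_zeta_le j l ω)

/-- Lindeberg sums of normalized sign-flipped combinations are controlled by those of the
score vectors. -/
theorem ofReal_integral_tail_le {t : Fin B → L → ℝ} {C ε : ℝ} (hC0 : 0 < C) (hε : 0 < ε)
    (hC : ∑ b, ∑ l, |t b l| ≤ C)
    (hL2 : ∀ l j, MemLp (E.zeta β₀ l (γ l) j) 2 E.P) :
    ENNReal.ofReal (∑ j, ∫ ω, {y : ℝ | ε < |y|}.indicator (fun y => y ^ 2)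
        ((√(E.total : ℝ))⁻¹ * E.flippedCombo β₀ γ t j ω) ∂E.P) ≤
      ENNReal.ofReal (C ^ 2) * (ENNReal.ofReal ((E.total : ℝ)⁻¹) *
        ∑ j, ∫⁻ ω in {ω | ε / C * √(E.total : ℝ) < ‖E.zetaVec β₀ γ j ω‖},
          ‖E.zetaVec β₀ γ j ω‖ₑ ^ 2 ∂E.P) := by
  set c := (√(E.total : ℝ))⁻¹ with hc
  have hc0 : 0 ≤ c := by positivity
  have hc2 : c ^ 2 = (E.total : ℝ)⁻¹ := by rw [hc, inv_pow, Real.sq_sqrt (Nat.cast_nonneg _)]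
  have hS : MeasurableSet {y : ℝ | ε < |y|} := measurableSet_lt measurable_const measurable_abs
  have hf0 : ∀ y : ℝ, 0 ≤ {y : ℝ | ε < |y|}.indicator (fun y => y ^ 2) y := fun y =>
    Set.indicator_nonneg (fun _ _ => sq_nonneg _) _
  rw [ENNReal.ofReal_sum_of_nonneg fun j _ => integral_nonneg fun ω => hf0 _, Finset.mul_sum,
    Finset.mul_sum]
  refine Finset.sum_le_sum fun j _ => ?_
  have hm := h.measurable_zetaVec (β₀ := β₀) (γ := γ) j
  have hAm : MeasurableSet {ω | ε / C * √(E.total : ℝ) < ‖E.zetaVec β₀ γ j ω‖} :=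
    measurableSet_lt measurable_const hm.norm
  have hξm : Measurable fun ω => c * E.flippedCombo β₀ γ t j ω :=
    (h.measurable_flippedCombo t j).const_mul c
  have hsq : Integrable (fun ω => (c * E.flippedCombo β₀ γ t j ω) ^ 2) E.P :=
    ((h.memLp_flippedCombo j (fun l => hL2 l j) t).const_mul c).integrable_sq
  have hint : Integrable (fun ω => {y : ℝ | ε < |y|}.indicator (fun y => y ^ 2)
      (c * E.flippedCombo β₀ γ t j ω)) E.P := by
    refine hsq.mono' (((measurable_id.pow_const 2).indicator hS).comp hξm).aestronglyMeasurable
      (ae_of_all _ fun ω => ?_)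
    rw [Real.norm_of_nonneg (hf0 _)]
    exact Set.indicator_le_self' (fun _ _ => sq_nonneg _) _
  rw [ofReal_integral_eq_lintegral_ofReal hint (ae_of_all _ fun ω => hf0 _), ← mul_assoc,
    ← ENNReal.ofReal_mul (sq_nonneg C), ← lintegral_const_mul' _ _ ENNReal.ofReal_ne_top,
    ← lintegral_indicator hAm]
  refine lintegral_mono_ae ?_
  filter_upwards [h.ae_abs_flippedCombo_le (β₀ := β₀) (γ := γ) t j] with ω hω
  by_cases hy : ε < |c * E.flippedCombo β₀ γ t j ω|
  · rw [Set.indicator_of_mem (show _ ∈ {y : ℝ | ε < |y|} from hy)]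
    have hle : |c * E.flippedCombo β₀ γ t j ω| ≤ c * C * ‖E.zetaVec β₀ γ j ω‖ := by
      rw [abs_mul, abs_of_nonneg hc0, mul_assoc]
      exact mul_le_mul_of_nonneg_left
        (hω.trans (mul_le_mul_of_nonneg_right hC (norm_nonneg _))) hc0
    -- if there are no observations, then `c = 0` by convention and the tail event is empty
    have hcpos : 0 < c := by
      rcases hc0.lt_or_eq with h0 | h0
      · exact h0
      · rw [← h0] at hy
        simp at hy
        exact absurd hy (not_lt.2 hε.le)
    have hroot : √(E.total : ℝ) = c⁻¹ := by rw [hc, inv_inv]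
    have hmem : ω ∈ {ω | ε / C * √(E.total : ℝ) < ‖E.zetaVec β₀ γ j ω‖} := by
      change ε / C * √(E.total : ℝ) < _
      rw [hroot, ← div_eq_mul_inv, div_div, div_lt_iff₀ (by positivity)]
      calc ε < _ := hy
        _ ≤ _ := hle
        _ = _ := by ring
    rw [Set.indicator_of_mem hmem, ← ofReal_norm, ← ENNReal.ofReal_pow (norm_nonneg _),
      ← ENNReal.ofReal_mul (by positivity)]
    refine ENNReal.ofReal_le_ofReal ?_
    calc (c * E.flippedCombo β₀ γ t j ω) ^ 2 = |c * E.flippedCombo β₀ γ t j ω| ^ 2 := (sq_abs _).symm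
      _ ≤ (c * C * ‖E.zetaVec β₀ γ j ω‖) ^ 2 := pow_le_pow_left₀ (abs_nonneg _) hle 2
      _ = _ := by rw [← hc2]; ring
  · rw [Set.indicator_of_notMem (show _ ∉ {y : ℝ | ε < |y|} from hy)]
    simp

/-- The characteristic-function bound for the sign-flipped scores of one experiment. -/
theorem norm_integral_cexp_flipped_sub_le
    (hL2 : ∀ l j, MemLp (E.zeta β₀ l (γ l) j) 2 E.P)
    (h0 : ∀ l j, E.P[E.zeta β₀ l (γ l) j | E.designSigma] =ᵐ[E.P] 0) (t : Fin B → L → ℝ)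
    {s ε δ : ℝ} (hs : 0 ≤ s) (hε0 : 0 < ε) (hε : ε ≤ 1) (hδ0 : 0 < δ) (hδ : δ ≤ 1) :
    ‖∫ ω, Complex.exp ((∑ j, (√(E.total : ℝ))⁻¹ * E.flippedCombo β₀ γ t j ω : ℝ) *
        Complex.I) ∂E.P - Real.exp (-s / 2)‖ ≤
      4 * ε * (s + 1) +
        (s + 5) * ∑ j, ∫ ω, {y : ℝ | ε < |y|}.indicator (fun y => y ^ 2)
          ((√(E.total : ℝ))⁻¹ * E.flippedCombo β₀ γ t j ω) ∂E.P +
        δ + 3 * E.P.real {ω | δ < |∑ b, ∑ l, ∑ l', t b l * t b l' * ((E.total : ℝ)⁻¹ *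
          ∑ j, E.designCov (E.zeta β₀ l (γ l) j) (E.zeta β₀ l' (γ l') j) ω) - s|} := by
  set c := (√(E.total : ℝ))⁻¹ with hc
  have hc2 : c ^ 2 = (E.total : ℝ)⁻¹ := by rw [hc, inv_pow, Real.sq_sqrt (Nat.cast_nonneg _)]
  have hcexp : Measurable fun x : ℝ => Complex.exp (x * Complex.I) :=
    (by fun_prop : Continuous fun x : ℝ => Complex.exp (x * Complex.I)).measurable
  have hvar : ∀ᵐ ω ∂E.P, ∑ j, (E.P[fun ω => (c * E.flippedCombo β₀ γ t j ω) ^ 2 |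
      E.designSigma]) ω = ∑ b, ∑ l, ∑ l', t b l * t b l' * ((E.total : ℝ)⁻¹ *
          ∑ j, E.designCov (E.zeta β₀ l (γ l) j) (E.zeta β₀ l' (γ l') j) ω) := by
    have hj : ∀ j, E.P[fun ω => (c * E.flippedCombo β₀ γ t j ω) ^ 2 | E.designSigma] =ᵐ[E.P]
        fun ω => c ^ 2 * ∑ b, ∑ l, ∑ l', t b l * t b l' *
          E.designCov (E.zeta β₀ l (γ l) j) (E.zeta β₀ l' (γ l') j) ω := by
      intro j
      have hfun : (fun ω => (c * E.flippedCombo β₀ γ t j ω) ^ 2) =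
          c ^ 2 • fun ω => E.flippedCombo β₀ γ t j ω ^ 2 := by
        ext ω
        simp [mul_pow]
      rw [hfun]
      filter_upwards [condExp_smul (μ := E.P) (c ^ 2)
        (fun ω => E.flippedCombo β₀ γ t j ω ^ 2) E.designSigma,
        h.condExp_flippedCombo_sq j (fun l => hL2 l j) (fun l => h0 l j) t] with ω a1 a2
      rw [a1, Pi.smul_apply, a2, smul_eq_mul]
    filter_upwards [ae_all_iff.2 hj] with ω hω
    simp only [hω, ← hc2]
    rw [← Finset.mul_sum, Finset.sum_comm, Finset.mul_sum]
    refine Finset.sum_congr rfl fun b _ => ?_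
    rw [Finset.sum_comm, Finset.mul_sum]
    refine Finset.sum_congr rfl fun l _ => ?_
    rw [Finset.sum_comm, Finset.mul_sum]
    refine Finset.sum_congr rfl fun l' _ => ?_
    rw [← Finset.mul_sum]
    ring
  have hmeas : E.P.real {ω | δ < |∑ j, (E.P[fun ω => (c * E.flippedCombo β₀ γ t j ω) ^ 2 |
      E.designSigma]) ω - s|} = E.P.real {ω | δ < |∑ b, ∑ l, ∑ l', t b l * t b l' *
      ((E.total : ℝ)⁻¹ * ∑ j, E.designCov (E.zeta β₀ l (γ l) j) (E.zeta β₀ l' (γ l') j) ω)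
        - s|} := by
    refine measureReal_congr ?_
    filter_upwards [hvar] with ω hω
    exact congrArg (fun x => δ < |x - s|) hω
  rw [← hmeas]
  refine norm_integral_cexp_sum_sub_le (D := E.designSigma)
    (G := fun k => E.designSigma ⊔ E.otherSigma k)
    (ξ := fun j ω => c * E.flippedCombo β₀ γ t j ω) h.designSigma_le (fun k => le_sup_left)
    (fun k => sup_le h.designSigma_le (h.otherSigma_le k))
    (fun j => (h.measurable_flippedCombo t j).const_mul c) (fun k j hjk => ?_)
    (fun j => (h.memLp_flippedCombo j (fun l => hL2 l j) t).const_mul c) (fun j => ?_)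
    (fun k => ?_) hs hε0 hε hδ0 hδ
  · exact ((h.measurable_flippedCombo_design_sup t j).mono
      (sup_le_sup_left (E.ownSigma_le_otherSigma hjk) _) le_rfl).const_mul c
  · filter_upwards [condExp_smul (μ := E.P) c (E.flippedCombo β₀ γ t j) E.designSigma,
      h.condExp_flippedCombo_eq_zero j (fun l => hL2 l j) (fun l => h0 l j) t] with ω a1 a2
    refine a1.trans ?_
    rw [Pi.smul_apply, a2]
    simp
  · refine h.condExp_design_sup_otherSigma k ?_ ?_
    · exact Integrable.of_bound (hcexp.comp
        ((h.measurable_flippedCombo t k).const_mul c)).aestronglyMeasurable 1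
        (ae_of_all _ fun ω => (Complex.norm_exp_ofReal_mul_I _).le)
    · exact (hcexp.comp ((h.measurable_flippedCombo_design_sup t k).const_mul c)).stronglyMeasurable

/-- Replacing the true nuisance parameter by its estimate changes a linear combination of the
flipped scores by at most a constant times the plug-in error. -/
theorem ae_abs_flippedScore_sub_le (t : Fin B → L → ℝ) :
    ∀ᵐ ω ∂E.P, |∑ b, ∑ l, t b l * E.flippedScore β₀ b l ω -
        ∑ j, (√(E.total : ℝ))⁻¹ * E.flippedCombo β₀ γ t j ω| ≤
      (∑ b, ∑ l, |t b l|) * ((√(E.total : ℝ))⁻¹ *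
        ∑ j, ‖E.zetaHatVec β₀ j ω - E.zetaVec β₀ γ j ω‖) := by
  filter_upwards [ae_all_iff.2 fun b => ae_all_iff.2 fun j => h.ae_abs_sign b j] with ω hω
  set c := (√(E.total : ℝ))⁻¹ with hc
  have hc0 : 0 ≤ c := by positivity
  have hcoord : ∀ l j, |E.zeta β₀ l (E.gammaHat β₀ l ω) j ω - E.zeta β₀ l (γ l) j ω| ≤
      ‖E.zetaHatVec β₀ j ω - E.zetaVec β₀ γ j ω‖ := fun l j =>
    PiLp.norm_apply_le (E.zetaHatVec β₀ j ω - E.zetaVec β₀ γ j ω) l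
  have hdiff : ∑ b, ∑ l, t b l * E.flippedScore β₀ b l ω -
      ∑ j, c * E.flippedCombo β₀ γ t j ω = ∑ b, ∑ l, t b l * (c * ∑ j, E.sign ω b j *
        (E.zeta β₀ l (E.gammaHat β₀ l ω) j ω - E.zeta β₀ l (γ l) j ω)) := by
    have h1 : ∑ j, c * E.flippedCombo β₀ γ t j ω =
        ∑ b, ∑ l, t b l * (c * ∑ j, E.sign ω b j * E.zeta β₀ l (γ l) j ω) := by
      simp only [flippedCombo, comboScore, Finset.mul_sum]
      rw [Finset.sum_comm]
      refine Finset.sum_congr rfl fun b _ => ?_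
      rw [Finset.sum_comm]
      refine Finset.sum_congr rfl fun l _ => Finset.sum_congr rfl fun j _ => ?_
      ring
    rw [h1, ← Finset.sum_sub_distrib]
    refine Finset.sum_congr rfl fun b _ => ?_
    rw [← Finset.sum_sub_distrib]
    refine Finset.sum_congr rfl fun l _ => ?_
    simp only [flippedScore, mul_sub, Finset.sum_sub_distrib, hc]
  rw [hdiff, Finset.sum_mul]
  refine (Finset.abs_sum_le_sum_abs _ _).trans (Finset.sum_le_sum fun b _ => ?_)
  rw [Finset.sum_mul]
  refine (Finset.abs_sum_le_sum_abs _ _).trans (Finset.sum_le_sum fun l _ => ?_)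
  rw [abs_mul, abs_mul, abs_of_nonneg hc0]
  refine mul_le_mul_of_nonneg_left (mul_le_mul_of_nonneg_left ?_ hc0) (abs_nonneg _)
  refine (Finset.abs_sum_le_sum_abs _ _).trans (Finset.sum_le_sum fun j _ => ?_)
  rw [abs_mul, hω b j, one_mul]
  exact hcoord l j

end Standing

end ClusterExperiment

/-! ### Limits along the sequence of experiments -/

/-- Characteristic functions of two variables that are close in probability are close. -/
theorem norm_integral_cexp_sub_le {Ω : Type*} [MeasurableSpace Ω] {μ : Measure Ω}
    [IsProbabilityMeasure μ] {f g : Ω → ℝ} (hf : Measurable f) (hg : Measurable g) {δ : ℝ}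
    (hδ : 0 ≤ δ) :
    ‖∫ ω, Complex.exp (f ω * Complex.I) ∂μ - ∫ ω, Complex.exp (g ω * Complex.I) ∂μ‖ ≤
      δ + 2 * μ.real {ω | δ < |f ω - g ω|} := by
  have hcexp : Measurable fun x : ℝ => Complex.exp (x * Complex.I) :=
    (by fun_prop : Continuous fun x : ℝ => Complex.exp (x * Complex.I)).measurable
  have hi : ∀ {f : Ω → ℝ}, Measurable f → Integrable (fun ω => Complex.exp (f ω * Complex.I)) μ :=
    fun hf => Integrable.of_bound (hcexp.comp hf).aestronglyMeasurable 1
      (ae_of_all _ fun ω => (Complex.norm_exp_ofReal_mul_I _).le)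
  have hA : MeasurableSet {ω | δ < |f ω - g ω|} :=
    measurableSet_lt measurable_const (measurable_abs.comp (hf.sub hg))
  rw [← integral_sub (hi hf) (hi hg)]
  have hbd : Integrable (fun ω => δ + {ω | δ < |f ω - g ω|}.indicator (fun _ => (2 : ℝ)) ω) μ :=
    (integrable_const _).add ((integrable_const _).indicator hA)
  refine (norm_integral_le_of_norm_le hbd (ae_of_all _ fun ω => ?_)).trans_eq ?_
  · by_cases hω : δ < |f ω - g ω|
    · rw [Set.indicator_of_mem (show ω ∈ {ω | δ < |f ω - g ω|} from hω)]
      refine (norm_sub_le _ _).trans ?_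
      rw [Complex.norm_exp_ofReal_mul_I, Complex.norm_exp_ofReal_mul_I]
      linarith
    · rw [Set.indicator_of_notMem (show ω ∉ {ω | δ < |f ω - g ω|} from hω), add_zero]
      refine le_trans ?_ (not_lt.1 hω)
      have h1 : Complex.exp (f ω * Complex.I) - Complex.exp (g ω * Complex.I) =
          Complex.exp (g ω * Complex.I) *
            (Complex.exp (Complex.I * ((f ω - g ω : ℝ) : ℂ)) - 1) := by
        rw [mul_sub, ← Complex.exp_add, mul_one]
        congr 2
        push_cast
        ring
      rw [h1, norm_mul, Complex.norm_exp_ofReal_mul_I, one_mul]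
      exact Real.norm_exp_I_mul_ofReal_sub_one_le
  · rw [integral_add (integrable_const _) ((integrable_const _).indicator hA),
      integral_indicator hA]
    simp [measureReal_def, mul_comm]

theorem MeanModel.condExp_zeta_eq_zero {L : Type v} {q : L → ℕ} {B : ℕ}
    {E : ℕ → ClusterExperiment.{u, v} L q B} {β₀ : L → ℝ} {γ : ∀ l, Fin (q l) → ℝ}
    (hE : ∀ k, (E k).Standing) (h1 : MeanModel E β₀ γ) {k : ℕ}
    (hL2 : ∀ l j, MemLp ((E k).zeta β₀ l (γ l) j) 2 (E k).P) (l : L) (j : Fin (E k).N) :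
    (E k).P[(E k).zeta β₀ l (γ l) j | (E k).designSigma] =ᵐ[(E k).P] 0 :=
  (hE k).condExp_zeta_eq_zero β₀ l (γ l) j (fun i => h1 k l j i)
    ((hL2 l j).integrable one_le_two)

section Limits

variable {L : Type v} [Fintype L] {q : L → ℕ} {B : ℕ} {E : ℕ → ClusterExperiment.{u, v} L q B}
  {β₀ : L → ℝ} {γ : ∀ l, Fin (q l) → ℝ} {S : Matrix L L ℝ}

/-- The Lindeberg condition makes the scores square integrable from some stage on. -/
theorem LindebergCondition.eventually_memLp (hE : ∀ k, (E k).Standing)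
    (hn : Tendsto (fun k => (E k).total) atTop atTop) (h4' : LindebergCondition E β₀ γ) :
    ∀ᶠ k in atTop, ∀ l j, MemLp ((E k).zeta β₀ l (γ l) j) 2 (E k).P := by
  filter_upwards [hn.eventually_gt_atTop 0, (h4' 1 one_pos).eventually_lt_const ENNReal.zero_lt_top]
    with k hk hfin
  exact (hE k).memLp_zeta_of_lindeberg hk hfin

/-- A limit of conditional covariance matrices is positive semidefinite. -/
theorem CovarianceLimit.posSemidef (hE : ∀ k, (E k).Standing)
    (hn : Tendsto (fun k => (E k).total) atTop atTop) (h1 : MeanModel E β₀ γ)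
    (h4 : CovarianceLimit E β₀ γ S) (h4' : LindebergCondition E β₀ γ) : S.PosSemidef := by
  refine Matrix.PosSemidef.of_dotProduct_mulVec_nonneg ?_ fun t => ?_
  · have hle : ∀ l l', 0 ≤ S l l' - S l' l := by
      intro l l'
      have := (h4 l l').add ((h4 l' l).const_mul (-1))
      rw [neg_one_mul, ← sub_eq_add_neg] at this
      refine this.nonneg (Eventually.of_forall fun k => ae_of_all _ fun ω => le_of_eq ?_)
      rw [neg_one_mul, ← sub_eq_add_neg, eq_comm, sub_eq_zero]
      simp only [ClusterExperiment.designCov, mul_comm]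
    ext l l'
    rw [Matrix.conjTranspose_apply, star_trivial]
    linarith [hle l l', hle l' l]
  · have hq : star t ⬝ᵥ S *ᵥ t = ∑ l, ∑ l', t l * t l' * S l l' := by
      simp only [star_trivial, dotProduct, Matrix.mulVec, Finset.mul_sum]
      exact Finset.sum_congr rfl fun l _ => Finset.sum_congr rfl fun l' _ => by ring
    rw [hq]
    refine (h4.quadraticForm t).nonneg ?_
    filter_upwards [h4'.eventually_memLp hE hn] with k hL2
    have h0 := h1.condExp_zeta_eq_zero hE hL2
    have hpos : ∀ j, 0 ≤ᵐ[(E k).P] (E k).P[fun ω => (E k).comboScore β₀ γ t j ω ^ 2 |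
        (E k).designSigma] := fun j => condExp_nonneg (ae_of_all _ fun ω => sq_nonneg _)
    filter_upwards [ae_all_iff.2 hpos, ae_all_iff.2 fun j =>
      ClusterExperiment.condExp_comboScore_sq j (fun l => hL2 l j) (fun l => h0 l j) t]
      with ω a1 a2
    have hsum : 0 ≤ ((E k).total : ℝ)⁻¹ * ∑ j, ∑ l, ∑ l', t l * t l' *
        (E k).designCov ((E k).zeta β₀ l (γ l) j) ((E k).zeta β₀ l' (γ l') j) ω :=
      mul_nonneg (by positivity) (Finset.sum_nonneg fun j _ => (a1 j).trans_eq (a2 j))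
    refine hsum.trans_eq ?_
    rw [Finset.sum_comm, Finset.mul_sum]
    refine Finset.sum_congr rfl fun l _ => ?_
    rw [Finset.sum_comm, Finset.mul_sum]
    refine Finset.sum_congr rfl fun l' _ => ?_
    rw [← Finset.mul_sum]
    ring

/-- The Lindeberg sums of the normalized sign-flipped combinations vanish. -/
theorem LindebergCondition.eventually_sum_tail_lt (hE : ∀ k, (E k).Standing)
    (hn : Tendsto (fun k => (E k).total) atTop atTop) (h4' : LindebergCondition E β₀ γ)
    (t : Fin B → L → ℝ) {ε η : ℝ} (hε : 0 < ε) (hη : 0 < η) :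
    ∀ᶠ k in atTop, ∑ j, ∫ ω, {y : ℝ | ε < |y|}.indicator (fun y => y ^ 2)
        ((√((E k).total : ℝ))⁻¹ * (E k).flippedCombo β₀ γ t j ω) ∂(E k).P < η := by
  set C : ℝ := ∑ b, ∑ l, |t b l| + 1 with hCdef
  have hC0 : 0 < C := by positivity
  have hC : ∑ b, ∑ l, |t b l| ≤ C := by linarith
  have hlim := ENNReal.Tendsto.const_mul (a := ENNReal.ofReal (C ^ 2)) (h4' (ε / C) (by positivity))
    (Or.inr ENNReal.ofReal_ne_top)
  rw [mul_zero] at hlim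
  filter_upwards [h4'.eventually_memLp hE hn,
    hlim.eventually_lt_const (ENNReal.ofReal_pos.2 hη)] with k hL2 hlt
  exact (ENNReal.ofReal_lt_ofReal_iff hη).1
    (((hE k).ofReal_integral_tail_le hC0 hε hC hL2).trans_lt hlt)

/-- Convergence of the characteristic function of the matrix of flipped scores. -/
theorem tendsto_integral_cexp_flippedScore (hE : ∀ k, (E k).Standing)
    (hn : Tendsto (fun k => (E k).total) atTop atTop) (h1 : MeanModel E β₀ γ)
    (h4 : CovarianceLimit E β₀ γ S) (h4' : LindebergCondition E β₀ γ)
    (h6 : NegligiblePlugIn E β₀ γ) (t : Fin B → L → ℝ) :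
    Tendsto (fun k => ∫ ω, Complex.exp ((∑ b, ∑ l, t b l * (E k).flippedScore β₀ b l ω : ℝ) *
      Complex.I) ∂(E k).P) atTop
      (𝓝 (Real.exp (-(∑ b, ∑ l, ∑ l', t b l * t b l' * S l l') / 2) : ℂ)) := by
  have hQ : TendstoInProb E _ (∑ b, ∑ l, ∑ l', t b l * t b l' * S l l') :=
    TendstoInProb.sum Finset.univ fun b => h4.quadraticForm (t b)
  have hR : TendstoInProb E _ ((∑ b, ∑ l, |t b l|) * 0) := h6.const_mul _
  rw [mul_zero] at hR
  have hs : 0 ≤ ∑ b, ∑ l, ∑ l', t b l * t b l' * S l l' := Finset.sum_nonneg fun b _ => by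
    have := (CovarianceLimit.posSemidef hE hn h1 h4 h4').dotProduct_mulVec_nonneg (t b)
    refine this.trans_eq ?_
    simp only [star_trivial, dotProduct, Matrix.mulVec, Finset.mul_sum]
    exact Finset.sum_congr rfl fun l _ => Finset.sum_congr rfl fun l' _ => by ring
  set s := ∑ b, ∑ l, ∑ l', t b l * t b l' * S l l' with hsdef
  rw [Metric.tendsto_nhds]
  intro η hη
  -- every one of the six error terms is at most `η / 6`
  obtain ⟨ε, hε0, hε1, hε⟩ : ∃ ε : ℝ, 0 < ε ∧ ε ≤ 1 ∧ 4 * ε * (s + 1) ≤ η / 6 := by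
    refine ⟨min 1 (η / (24 * (s + 1))), by positivity, min_le_left _ _, ?_⟩
    have := min_le_right 1 (η / (24 * (s + 1)))
    rw [le_div_iff₀ (by positivity)] at this
    linarith
  obtain ⟨δ, hδ0, hδ1, hδ⟩ : ∃ δ : ℝ, 0 < δ ∧ δ ≤ 1 ∧ δ ≤ η / 6 :=
    ⟨min 1 (η / 6), by positivity, min_le_left _ _, min_le_right _ _⟩
  filter_upwards [h4'.eventually_memLp hE hn,
    h4'.eventually_sum_tail_lt hE hn t hε0 (show 0 < η / 6 / (s + 5) by positivity),
    hQ.eventually_real_lt hδ0 (show 0 < η / 18 by positivity),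
    hR.eventually_real_lt hδ0 (show 0 < η / 12 by positivity)] with k hL2 a1 a2 a3
  have b1 := (hE k).norm_integral_cexp_flipped_sub_le hL2 (h1.condExp_zeta_eq_zero hE hL2) t hs hε0
    hε1 hδ0 hδ1
  have b2 := norm_integral_cexp_sub_le (μ := (E k).P)
    (f := fun ω => ∑ b, ∑ l, t b l * (E k).flippedScore β₀ b l ω)
    (g := fun ω => ∑ j, (√((E k).total : ℝ))⁻¹ * (E k).flippedCombo β₀ γ t j ω)
    (Finset.measurable_fun_sum _ fun b _ => Finset.measurable_fun_sum _ fun l _ =>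
      ((hE k).measurable_flippedScore β₀ b l).const_mul _)
    (Finset.measurable_fun_sum _ fun j _ => ((hE k).measurable_flippedCombo t j).const_mul _) hδ0.le
  have b3 : (E k).P.real {ω | δ < |∑ b, ∑ l, t b l * (E k).flippedScore β₀ b l ω -
      ∑ j, (√((E k).total : ℝ))⁻¹ * (E k).flippedCombo β₀ γ t j ω|} < η / 12 := by
    refine lt_of_le_of_lt (ENNReal.toReal_mono (measure_ne_top _ _) (measure_mono_ae ?_)) a3
    filter_upwards [(hE k).ae_abs_flippedScore_sub_le (β₀ := β₀) (γ := γ) t] with ω hω hlt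
    exact lt_of_lt_of_le (lt_of_lt_of_le hlt hω) (by rw [sub_zero]; exact le_abs_self _)
  rw [lt_div_iff₀ (by positivity)] at a1
  rw [dist_eq_norm]
  refine lt_of_le_of_lt (norm_sub_le_norm_sub_add_norm_sub _ _ _) (lt_of_le_of_lt
    (add_le_add b2 b1) ?_)
  linarith

end Limits

/-! ### Gaussian matrices and the limit theorem -/

theorem dotProduct_one_kronecker_mulVec {ι L : Type*} [Fintype ι] [DecidableEq ι] [Fintype L]
    (S : Matrix L L ℝ) (t : ι × L → ℝ) :
    t ⬝ᵥ ((1 : Matrix ι ι ℝ) ⊗ₖ S) *ᵥ t =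
      ∑ b, ∑ l, ∑ l', t (b, l) * t (b, l') * S l l' := by
  simp only [dotProduct, Matrix.mulVec, Matrix.kroneckerMap_apply, Fintype.sum_prod_type,
    Finset.mul_sum]
  refine Finset.sum_congr rfl fun b _ => Finset.sum_congr rfl fun l _ => ?_
  rw [Finset.sum_eq_single b]
  · exact Finset.sum_congr rfl fun l' _ => by rw [Matrix.one_apply_eq]; ring
  · intro b' _ hb
    exact Finset.sum_eq_zero fun l' _ => by rw [Matrix.one_apply_ne hb.symm]; ring
  · simp

/-- The rows of a Gaussian matrix whose stacked covariance is `1 ⊗ S` are independent with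
covariance `S`. -/
theorem map_multivariateGaussian_one_kronecker {ι L : Type*} [Fintype ι] [DecidableEq ι]
    [Fintype L] [DecidableEq L] {S : Matrix L L ℝ} (hS : S.PosSemidef) :
    (multivariateGaussian (0 : EuclideanSpace ℝ (ι × L)) ((1 : Matrix ι ι ℝ) ⊗ₖ S)).map
        (fun x b => (WithLp.toLp 2 fun l => x (b, l) : EuclideanSpace ℝ L)) =
      Measure.pi fun _ : ι => multivariateGaussian (0 : EuclideanSpace ℝ L) S := by
  have hg : Measurable fun (x : EuclideanSpace ℝ (ι × L)) (b : ι) =>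
      (WithLp.toLp 2 fun l => x (b, l) : EuclideanSpace ℝ L) := by fun_prop
  have := Measure.isProbabilityMeasure_map (μ := multivariateGaussian
    (0 : EuclideanSpace ℝ (ι × L)) ((1 : Matrix ι ι ℝ) ⊗ₖ S)) hg.aemeasurable
  refine charFun_eq_pi_iff.1 fun t => ?_
  have hK : ((1 : Matrix ι ι ℝ) ⊗ₖ S).PosSemidef := Matrix.PosSemidef.one.kronecker hS
  have h1 : charFun (((multivariateGaussian (0 : EuclideanSpace ℝ (ι × L))
      ((1 : Matrix ι ι ℝ) ⊗ₖ S)).map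
        (fun x b => (WithLp.toLp 2 fun l => x (b, l) : EuclideanSpace ℝ L))).map
          (WithLp.toLp 2)) t =
      charFun (multivariateGaussian (0 : EuclideanSpace ℝ (ι × L)) ((1 : Matrix ι ι ℝ) ⊗ₖ S))
        (WithLp.toLp 2 fun p : ι × L => t p.1 p.2) := by
    rw [Measure.map_map (WithLp.measurable_toLp 2 _) hg, charFun_apply, charFun_apply,
      integral_map ((WithLp.measurable_toLp 2 _).comp hg).aemeasurable (by fun_prop)]
    congr 1
    ext x
    simp [PiLp.inner_apply, Fintype.sum_prod_type]
  rw [h1, charFun_multivariateGaussian hK]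
  simp only [charFun_multivariateGaussian hS]
  rw [dotProduct_one_kronecker_mulVec, ← Complex.exp_sum]
  congr 1
  simp only [inner_zero_right, Complex.ofReal_zero, zero_mul, zero_sub, Finset.sum_neg_distrib,
    ← Finset.sum_div, ← Complex.ofReal_sum]
  congr 3
  refine Finset.sum_congr rfl fun b _ => ?_
  simp only [dotProduct, Matrix.mulVec, Finset.mul_sum]
  exact Finset.sum_congr rfl fun l _ => Finset.sum_congr rfl fun l' _ => by ring

theorem mainTheorem2 {L : Type v} [Fintype L] [DecidableEq L] (q : L → ℕ) (B : ℕ)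
    (E : ℕ → ClusterExperiment.{u, v} L q B)
    (β β₀ : L → ℝ) (γ : ∀ l, Fin (q l) → ℝ) (S : Matrix L L ℝ)
    (hE : ∀ k, (E k).Standing)
    (hn : Tendsto (fun k => (E k).total) atTop atTop)
    (hnull : ∀ l, β l = β₀ l)
    (h1 : MeanModel E β γ)
    (h2 : NegligibleClusters E)
    (h3 : LyapunovCondition E β₀ γ)
    (hSdiag : ∀ l, 0 < S l l)
    (h4 : CovarianceLimit E β₀ γ S)
    (h4' : LindebergCondition E β₀ γ)
    (h5 : NuisanceRate E β₀ γ)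
    (h6 : NegligiblePlugIn E β₀ γ) :
    S.PosSemidef ∧
    TendstoInDistribution
      (fun k ω (b : Fin B) =>
        (WithLp.toLp 2 (fun l => (E k).flippedScore β₀ b l ω) : EuclideanSpace ℝ L))
      atTop id (fun k => (E k).P)
      (Measure.pi fun _ : Fin B => multivariateGaussian (0 : EuclideanSpace ℝ L) S) ∧
    TendstoInDistribution
      (fun k ω =>
        (WithLp.toLp 2 (fun p : Fin B × L => (E k).flippedScore β₀ p.1 p.2 ω) :
          EuclideanSpace ℝ (Fin B × L)))
      atTop id (fun k => (E k).P)
      (multivariateGaussian (0 : EuclideanSpace ℝ (Fin B × L))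
        ((1 : Matrix (Fin B) (Fin B) ℝ) ⊗ₖ S)) := by
  have hβ : β = β₀ := funext hnull
  subst hβ
  have hS : S.PosSemidef := h4.posSemidef hE hn h1 h4'
  have hK : ((1 : Matrix (Fin B) (Fin B) ℝ) ⊗ₖ S).PosSemidef := Matrix.PosSemidef.one.kronecker hS
  have hm : ∀ k, Measurable fun ω => (WithLp.toLp 2 (fun p : Fin B × L =>
      (E k).flippedScore β p.1 p.2 ω) : EuclideanSpace ℝ (Fin B × L)) := fun k =>
    (WithLp.measurable_toLp 2 _).comp
      (measurable_pi_lambda _ fun p => (hE k).measurable_flippedScore β p.1 p.2)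
  have hvec : TendstoInDistribution
      (fun k ω =>
        (WithLp.toLp 2 (fun p : Fin B × L => (E k).flippedScore β p.1 p.2 ω) :
          EuclideanSpace ℝ (Fin B × L)))
      atTop id (fun k => (E k).P)
      (multivariateGaussian (0 : EuclideanSpace ℝ (Fin B × L))
        ((1 : Matrix (Fin B) (Fin B) ℝ) ⊗ₖ S)) := by
    refine ⟨fun k => (hm k).aemeasurable, aemeasurable_id, ?_⟩
    refine ProbabilityMeasure.tendsto_iff_tendsto_charFun.2 fun t => ?_
    have hlim := tendsto_integral_cexp_flippedScore hE hn h1 h4 h4' h6 fun b l => t (b, l)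
    have hcf : charFun (multivariateGaussian (0 : EuclideanSpace ℝ (Fin B × L))
        ((1 : Matrix (Fin B) (Fin B) ℝ) ⊗ₖ S)) t =
        (Real.exp (-(∑ b, ∑ l, ∑ l', t (b, l) * t (b, l') * S l l') / 2) : ℂ) := by
      rw [charFun_multivariateGaussian hK, dotProduct_one_kronecker_mulVec]
      simp [neg_div]
    simp only [ProbabilityMeasure.coe_mk, Measure.map_id, hcf]
    refine hlim.congr fun k => ?_
    rw [charFun_apply, integral_map (hm k).aemeasurable (by fun_prop)]
    congr 1
    ext ω
    congr 2
    simp [PiLp.inner_apply, Fintype.sum_prod_type]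
  refine ⟨hS, ?_, hvec⟩
  -- the rows are a continuous image of the stacked vector
  have hg : Continuous fun (x : EuclideanSpace ℝ (Fin B × L)) (b : Fin B) =>
      (WithLp.toLp 2 fun l => x (b, l) : EuclideanSpace ℝ L) := by fun_prop
  have hrows := hvec.continuous_comp hg
  refine ⟨hrows.forall_aemeasurable, aemeasurable_id, ?_⟩
  refine hrows.tendsto.mono_right (le_of_eq (congrArg 𝓝 (Subtype.ext ?_)))
  change Measure.map _ _ = Measure.map id _
  rw [Measure.map_id, Function.comp_id]
  exact map_multivariateGaussian_one_kronecker hS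

end
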